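/- For $g\in L^2(\mathbb R)$ let $G(g)=\{e^{2\pi i m x}g(x-n)\}_{(m,n)\in\mathbb Z^2}$ and let $\widehat g$ be its Fourier transform, the unitary extension to $L^2(\mathbb R)$ of $\widehat g(\xi)=\int_{\mathbb R} g(x)e^{-2\pi i x\xi}\,dx$. A system $\{f_n\}$ in a Hilbert space $H$ is called exact if it is complete (its closed linear span is $H$) and minimal (each $f_n$ lies outside the closed linear span of the remaining elements). For $2\le q<\infty$ it is called a $(C_q)$-system if there is a constant $C>0$ such that every $f\in H$ can be approximated arbitrarily well by finite linear combinations $\sum a_nf_n$ with $\left(\sum|a_n|^q\right)^{1/q}\le C\|f\|_H$. An exact $(C_q)$-system is a $(C_q)$-system that is exact. Theorem. Let $2<q<\infty$, let $q'=q/(q-1)$, and let $t\ge r>\frac{4(q-1)}{q+2}$ be real numbers such that $$\frac1r+\frac1t\le\frac{q'}{2}.$$ Let $g\in L^2(\mathbb R)$. If $G(g)$ is an exact $(C_q)$-system for $L^2(\mathbb R)$, then $$\int_{\mathbb R}|x|^r|g(x)|^2\,dx=\infty\quad\text{or}\quad\int_{\mathbb R}|\xi|^t|\widehat g(\xi)|^2\,d\xi=\infty,$$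 and likewise, with $r$ and $t$ interchanged, $$\int_{\mathbb R}|x|^t|g(x)|^2\,dx=\infty\quad\text{or}\quad\int_{\mathbb R}|\xi|^r|\widehat g(\xi)|^2\,d\xi=\infty.$$ -/

import Mathlib

open MeasureTheory
open scoped FourierTransform ENNReal

noncomputable section

section Systems

variable {ι H : Type*} [NormedAddCommGroup H] [InnerProductSpace ℂ H]

/-- A system is complete if its closed linear span is the whole space. -/
def IsCompleteSystem (f : ι → H) : Prop :=
  (Submodule.span ℂ (Set.range f)).topologicalClosure = ⊤

/-- A system is minimal if each of its elements lies outside the closed linear span of the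
remaining elements. -/
def IsMinimalSystem (f : ι → H) : Prop :=
  ∀ i, f i ∉ (Submodule.span ℂ (f '' {j | j ≠ i})).topologicalClosure

/-- A system is exact if it is both complete and minimal. -/
def IsExactSystem (f : ι → H) : Prop :=
  IsCompleteSystem f ∧ IsMinimalSystem f

/-- The `ℓ^q` norm of a finite family of coefficients (for a finite exponent `q`). -/
def finiteLqNorm (q : ℝ) (a : ι →₀ ℂ) : ℝ :=
  (∑ i ∈ a.support, ‖a i‖ ^ q) ^ (1 / q)

/-- A system is a `(C_q)`-system if there is a constant `C > 0` such that every `h` can be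
approximated arbitrarily well by finite linear combinations `∑ a i • f i` whose coefficients
satisfy `‖a‖_{ℓ^q} ≤ C ‖h‖`. -/
def IsCqSystem (q : ℝ) (f : ι → H) : Prop :=
  ∃ C : ℝ, 0 < C ∧ ∀ h : H, ∀ ε : ℝ, 0 < ε →
    ∃ a : ι →₀ ℂ, ‖h - ∑ i ∈ a.support, a i • f i‖ < ε ∧ finiteLqNorm q a ≤ C * ‖h‖

/-- An exact `(C_q)`-system. -/
def IsExactCqSystem (q : ℝ) (f : ι → H) : Prop :=
  IsExactSystem f ∧ IsCqSystem q f

end Systems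

/-- The time-frequency shift `x ↦ e^{2πimx} g(x - n)` as a function on `ℝ`. -/
def gaborFun (g : Lp ℂ 2 (volume : Measure ℝ)) (m n : ℤ) (x : ℝ) : ℂ :=
  Complex.exp (2 * Real.pi * Complex.I * m * x) * g (x - n)

theorem memLp_gaborFun (g : Lp ℂ 2 (volume : Measure ℝ)) (m n : ℤ) :
    MemLp (gaborFun g m n) 2 volume := by
  have h1 : MemLp (fun x : ℝ => g (x - n)) 2 volume :=
    (Lp.memLp g).comp_measurePreserving (measurePreserving_sub_right volume (n : ℝ))
  refine h1.of_le ?_ ?_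
  · exact AEStronglyMeasurable.mul (by fun_prop) h1.1
  · refine Filter.Eventually.of_forall fun x => ?_
    have h2 : ‖Complex.exp (2 * Real.pi * Complex.I * m * x)‖ = 1 := by
      have h3 : (2 * Real.pi * Complex.I * m * x : ℂ)
          = ((2 * Real.pi * m * x : ℝ) : ℂ) * Complex.I := by
        push_cast; ring
      rw [h3, Complex.norm_exp_ofReal_mul_I]
    simp only [gaborFun, norm_mul, h2, one_mul, le_refl]

/-- The Gabor system `G(g) = {e^{2πimx} g(x - n)}`, indexed by `(m, n) ∈ ℤ²`, in `L²(ℝ)`. -/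
def gaborSystem (g : Lp ℂ 2 (volume : Measure ℝ)) : ℤ × ℤ → Lp ℂ 2 (volume : Measure ℝ) :=
  fun p => (memLp_gaborFun g p.1 p.2).toLp (gaborFun g p.1 p.2)

/-- The moment `∫ |x|^s |f(x)|² dx`, as a value in `[0, ∞]`. -/
def momentL2 (s : ℝ) (f : Lp ℂ 2 (volume : Measure ℝ)) : ℝ≥0∞ :=
  ∫⁻ x : ℝ, ENNReal.ofReal (|x| ^ s * ‖f x‖ ^ 2)

end

noncomputable section

open scoped SchwartzMap ContDiff ComplexConjugate

/-! Suppose both moments are finite. Multiply the integer translates of `g` by a smooth window near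
a point `x₀` and take Fourier coefficients `c(m, n)`: the moments give `∑ |c(m, n)|² (1 + |m|^t +
|n|^r) < ∞` (`exists_continuous_windowCoeff_summable`). Since `1/r + 1/t < 1`, the family `c` is
absolutely summable, so the Zak transform `Z` of `g` is continuous. Being quasi-periodic, `Z` has a
zero `(x₀, y₀)` (`exists_zero_of_quasiperiodic`).

In a minimal `(C_q)`-system the `ℓ^q` bound holds for every finite combination
(`IsCqSystem.finiteLqNorm_le`). It is tested on coefficients `A m * B n` whose trigonometric
polynomials approximate bumps of widths `a` and `b` at `x₀` and `-y₀`. Their `ℓ^q` norm is at least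
of order `(ab)^(1/q')`. The norm of the combination is an `L²` norm of the polynomials against `Z`,
so it is at most of order `(ab)^(1/2)` times the size of `Z` on an `a × b` rectangle about its zero.

With `a = ε^(2/t)` and `b = ε^(2/r)`, Cauchy–Schwarz gives `|Z| = o(ε^(1 - 1/r - 1/t))` on that
rectangle (`tsum_norm_mul_min_isLittleO`). If `1/r + 1/t = q'/2`, then `ab = ε^(q')`: the lower
bound is of order `ε`, the upper bound is `o(ε)`, a contradiction. The case `1/r + 1/t < q'/2`
follows by lowering the exponents; the threshold on `r` keeps the estimate near the zero valid at
the lowered exponents. -/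

/-! ### Characters and Fourier series on an interval of unit length -/

/-- The character `s ↦ e^{2πis}` of `ℝ`. -/
def unitExp (s : ℝ) : ℂ := Complex.exp (2 * Real.pi * Complex.I * s)

theorem unitExp_eq (s : ℝ) : unitExp s = Complex.exp ((2 * Real.pi * s : ℝ) * Complex.I) := by
  unfold unitExp; congr 1; push_cast; ring

@[simp] theorem norm_unitExp (s : ℝ) : ‖unitExp s‖ = 1 := by
  rw [unitExp_eq, Complex.norm_exp_ofReal_mul_I]

theorem unitExp_add (s t : ℝ) : unitExp (s + t) = unitExp s * unitExp t := by
  unfold unitExp; rw [← Complex.exp_add]; congr 1; push_cast; ring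

@[simp] theorem unitExp_zero : unitExp 0 = 1 := by simp [unitExp]

@[simp] theorem unitExp_intCast (n : ℤ) : unitExp n = 1 := by
  unfold unitExp
  rw [Complex.exp_eq_one_iff]
  exact ⟨n, by push_cast; ring⟩

theorem unitExp_ne_zero (s : ℝ) : unitExp s ≠ 0 := Complex.exp_ne_zero _

theorem continuous_unitExp : Continuous unitExp := by unfold unitExp; fun_prop

theorem norm_unitExp_sub_one_le (s : ℝ) : ‖unitExp s - 1‖ ≤ 2 * Real.pi * |s| := by
  rw [unitExp_eq, mul_comm]
  refine (Real.norm_exp_I_mul_ofReal_sub_one_le).trans ?_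
  rw [Real.norm_eq_abs, abs_mul, abs_of_pos Real.two_pi_pos]

theorem norm_unitExp_sub_one_le_min (s : ℝ) : ‖unitExp s - 1‖ ≤ 2 * Real.pi * min 1 |s| := by
  rw [mul_min_of_nonneg _ _ Real.two_pi_pos.le]
  refine le_min ?_ (norm_unitExp_sub_one_le s)
  refine (norm_sub_le _ _).trans ?_
  simp only [norm_unitExp, norm_one]
  linarith [Real.pi_gt_three]

theorem fourier_eq_unitExp (a : ℝ) (n : ℤ) (x : ℝ) :
    fourier n (x : AddCircle (a + 1 - a)) = unitExp (n * x) := by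
  rw [fourier_coe_apply, unitExp]; congr 1; push_cast; ring

theorem fourierCoeffOn_eq_unitExp (a : ℝ) (f : ℝ → ℂ) (n : ℤ) :
    fourierCoeffOn (lt_add_one a) f n = ∫ x in a..a + 1, unitExp (-(n * x)) * f x := by
  rw [fourierCoeffOn_eq_integral]
  simp only [fourier_eq_unitExp, add_sub_cancel_left]
  simp

/-- **Parseval's identity** on an interval of unit length. -/
theorem hasSum_sq_norm_integral_unitExp (a : ℝ) {f : ℝ → ℂ}
    (hf : MemLp f 2 (volume.restrict (Set.Ioc a (a + 1)))) :
    HasSum (fun n : ℤ => ‖∫ x in a..a + 1, unitExp (-(n * x)) * f x‖ ^ 2)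
      (∫ x in a..a + 1, ‖f x‖ ^ 2) := by
  have h := hasSum_sq_fourierCoeffOn (lt_add_one a) hf
  simpa [fourierCoeffOn_eq_unitExp] using h

/-- A continuous function on an interval of unit length, vanishing at the end points, is the sum
of its Fourier series if that series is absolutely convergent. -/
theorem hasSum_unitExp_of_summable (a : ℝ) {f : ℝ → ℂ} (hf : Continuous f) (h0 : f a = 0)
    (h1 : f (a + 1) = 0)
    (hs : Summable fun n : ℤ => ∫ x in a..a + 1, unitExp (-(n * x)) * f x)
    {x : ℝ} (hx : x ∈ Set.Ico a (a + 1)) :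
    HasSum (fun n : ℤ => (∫ x in a..a + 1, unitExp (-(n * x)) * f x) * unitExp (n * x)) (f x) := by
  have : Fact (0 < a + 1 - a) := ⟨by linarith⟩
  have hc : Continuous (AddCircle.liftIco (a + 1 - a) a f) := by
    apply AddCircle.liftIco_continuous
    · rw [show a + (a + 1 - a) = a + 1 by ring, h0, h1]
    · exact hf.continuousOn
  have hco : fourierCoeff (AddCircle.liftIco (a + 1 - a) a f)
      = fun n : ℤ => ∫ x in a..a + 1, unitExp (-(n * x)) * f x := by
    funext n
    rw [fourierCoeff_liftIco_eq (T := a + 1 - a) (a := a) f n, ← fourierCoeffOn_eq_unitExp]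
    congr 1; ring
  have := has_pointwise_sum_fourier_series_of_summable (T := a + 1 - a) (f := ⟨_, hc⟩)
    (by rw [ContinuousMap.coe_mk, hco]; exact hs) (x : AddCircle (a + 1 - a))
  simp only [ContinuousMap.coe_mk, hco, fourier_eq_unitExp, smul_eq_mul] at this
  rwa [AddCircle.liftIco_coe_apply (by simpa using hx)] at this

theorem hasSum_integral_unitExp_mul {d : ℤ → ℂ} (hd : Summable d) (p : ℤ) :
    ∫ y in (0 : ℝ)..0 + 1, unitExp (-(p * y)) * ∑' k : ℤ, d k * unitExp (k * y) = d p := by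
  have key : ∀ k : ℤ, ∫ y in (0 : ℝ)..0 + 1, unitExp (-(p * y)) * (d k * unitExp (k * y))
      = if k = p then d p else 0 := by
    intro k
    have : Fact (0 < (0 : ℝ) + 1 - 0) := ⟨by norm_num⟩
    have h := congrFun (fourierCoeff_fourier (T := (0 : ℝ) + 1 - 0) k) p
    rw [fourierCoeff_eq_intervalIntegral _ _ 0] at h
    simp only [fourier_eq_unitExp] at h
    simp only [smul_eq_mul] at h
    have h2 : ∫ y in (0 : ℝ)..0 + 1, unitExp (-(p * y)) * unitExp (k * y)
        = Pi.single (M := fun _ => ℂ) k 1 p := by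
      rw [← h]; norm_num
    simp_rw [show ∀ y : ℝ, unitExp (-(p * y)) * (d k * unitExp (k * y))
      = d k * (unitExp (-(p * y)) * unitExp (k * y)) from fun y => by ring]
    rw [intervalIntegral.integral_const_mul, h2]
    by_cases hkp : k = p
    · subst hkp; simp
    · rw [Pi.single_eq_of_ne (Ne.symm hkp)]; simp [hkp]
  have hn : ∀ k : ℤ, ∀ y : ℝ, ‖unitExp (-(p * y)) * (d k * unitExp (k * y))‖ = ‖d k‖ := by
    intro k y; simp
  have h := intervalIntegral.hasSum_integral_of_dominated_convergence (μ := volume)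
    (a := (0 : ℝ)) (b := 0 + 1)
    (F := fun (k : ℤ) (y : ℝ) => unitExp (-(p * y)) * (d k * unitExp (k * y)))
    (f := fun y => unitExp (-(p * y)) * ∑' k : ℤ, d k * unitExp (k * y))
    (fun k _ => ‖d k‖) (fun k => by
      apply Continuous.aestronglyMeasurable
      exact (continuous_unitExp.comp (by fun_prop)).mul
        (continuous_const.mul (continuous_unitExp.comp (by fun_prop))))
    (fun k => Filter.Eventually.of_forall fun y _ => (hn k y).le)
    (Filter.Eventually.of_forall fun y _ => hd.norm)
    (by simp)
    (Filter.Eventually.of_forall fun y _ => by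
      apply HasSum.mul_left
      apply Summable.hasSum
      refine Summable.of_norm ?_
      simpa using hd.norm)
  simp only [key] at h
  exact h.unique (by simpa using hasSum_ite_eq p (d p))

theorem continuous_tsum_unitExp {d : ℤ → ℂ} (hd : Summable d) :
    Continuous fun y : ℝ => ∑' k : ℤ, d k * unitExp (k * y) := by
  refine continuous_tsum (u := fun k => ‖d k‖) (fun k => ?_) hd.norm (fun k y => by simp)
  exact continuous_const.mul (continuous_unitExp.comp (by fun_prop))

theorem hasSum_sq_norm_of_summable {d : ℤ → ℂ} (hd : Summable d) :
    HasSum (fun p : ℤ => ‖d p‖ ^ 2)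
      (∫ y in (0 : ℝ)..0 + 1, ‖∑' k : ℤ, d k * unitExp (k * y)‖ ^ 2) := by
  have h := hasSum_sq_norm_integral_unitExp 0 (f := fun y => ∑' k : ℤ, d k * unitExp (k * y)) ?_
  · simpa only [hasSum_integral_unitExp_mul hd] using h
  · have := (continuous_tsum_unitExp hd)
    refine MemLp.of_bound this.aestronglyMeasurable (∑' k, ‖d k‖)
      (Filter.Eventually.of_forall fun y => ?_)
    refine (norm_tsum_le_tsum_norm (by simpa using hd.norm)).trans (by simp)

/-! ### Minimal `(C_q)`-systems -/

section Abstract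

variable {ι H : Type*} [NormedAddCommGroup H] [InnerProductSpace ℂ H]

/-- Coefficients with respect to a minimal system are bounded functionals of finite linear
combinations. -/
theorem IsMinimalSystem.exists_coeff_bound {f : ι → H} (hf : IsMinimalSystem f) (i : ι) :
    ∃ d : ℝ, 0 < d ∧ ∀ a : ι →₀ ℂ, d * ‖a i‖ ≤ ‖∑ j ∈ a.support, a j • f j‖ := by
  classical
  set V := (Submodule.span ℂ (f '' {j | j ≠ i})).topologicalClosure with hV
  have hcl : IsClosed (V : Set H) := Submodule.isClosed_topologicalClosure _
  have hne : (V : Set H).Nonempty := ⟨0, V.zero_mem⟩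
  have hpos : 0 < Metric.infDist (f i) V := (hcl.notMem_iff_infDist_pos hne).1 (hf i)
  refine ⟨_, hpos, fun a => ?_⟩
  by_cases hi : a i = 0
  · simp [hi]
  have hmem : i ∈ a.support := by simpa using hi
  rw [← Finset.add_sum_erase _ _ hmem]
  set v := ∑ j ∈ a.support.erase i, a j • f j with hv
  have hvV : v ∈ V := by
    refine V.sum_mem fun j hj => V.smul_mem _ ?_
    refine Submodule.le_topologicalClosure _ (Submodule.subset_span ?_)
    exact ⟨j, (Finset.mem_erase.1 hj).1, rfl⟩
  -- Factoring out `a i` leaves the difference of `f i` and a point of `V`, so the distance from `f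
  -- i` to `V` serves as the constant.
  have h1 : a i • f i + v = a i • (f i - (-(a i)⁻¹ • v)) := by
    rw [smul_sub, smul_smul, mul_neg, mul_inv_cancel₀ hi]; simp
  rw [h1, norm_smul, mul_comm, ← dist_eq_norm]
  gcongr
  exact Metric.infDist_le_dist_of_mem (V.smul_mem _ hvV)

/-- In a minimal `(C_q)`-system every finite linear combination satisfies the `ℓ^q` bound. -/
theorem IsCqSystem.finiteLqNorm_le {f : ι → H} {q : ℝ} (hq : 0 < q) (hmin : IsMinimalSystem f)
    (hcq : IsCqSystem q f) :
    ∃ C : ℝ, 0 < C ∧ ∀ a : ι →₀ ℂ,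
      finiteLqNorm q a ≤ C * ‖∑ j ∈ a.support, a j • f j‖ := by
  classical
  obtain ⟨C, hC, h⟩ := hcq
  refine ⟨C, hC, fun a => ?_⟩
  set x := ∑ j ∈ a.support, a j • f j with hx
  -- The approximants `b n` carry the `ℓ^q` bound. Minimality makes each coefficient of `b n`
  -- converge to that of `a`, so the bound passes to the limit on the finite support of `a`.
  choose b hb1 hb2 using fun n : ℕ => h x (1 / (n + 1)) (by positivity)
  have hlim : ∀ i, Filter.Tendsto (fun n => b n i) Filter.atTop (nhds (a i)) := by
    intro i
    obtain ⟨d, hd, hd2⟩ := hmin.exists_coeff_bound i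
    rw [tendsto_iff_norm_sub_tendsto_zero]
    refine squeeze_zero (fun _ => norm_nonneg _) (g := fun n : ℕ => d⁻¹ * (1 / ((n : ℝ) + 1)))
      (fun n => ?_) ?_
    · have h1 := hd2 (a - b n)
      have h2 : ∑ j ∈ (a - b n).support, (a - b n) j • f j
          = x - ∑ j ∈ (b n).support, b n j • f j := by
        have e : ∀ c : ι →₀ ℂ, ∑ j ∈ c.support, c j • f j = Finsupp.linearCombination ℂ f c :=
          fun c => rfl
        rw [hx, e, e, e, map_sub]
      rw [h2] at h1
      rw [norm_sub_rev]
      rw [inv_mul_eq_div, le_div_iff₀ hd, mul_comm]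
      exact h1.trans (hb1 n).le
    · simpa using (tendsto_one_div_add_atTop_nhds_zero_nat (𝕜 := ℝ)).const_mul d⁻¹
  have hfin : ∀ n, ∑ i ∈ a.support, ‖b n i‖ ^ q ≤ (C * ‖x‖) ^ q := by
    intro n
    have h1 : ∑ i ∈ a.support, ‖b n i‖ ^ q ≤ ∑ i ∈ (b n).support, ‖b n i‖ ^ q := by
      rw [← Finset.sum_filter_ne_zero]
      refine Finset.sum_le_sum_of_subset_of_nonneg ?_ fun _ _ _ => by positivity
      intro i hi
      rw [Finset.mem_filter] at hi
      rw [Finsupp.mem_support_iff]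
      intro h0
      apply hi.2
      rw [h0, norm_zero, Real.zero_rpow hq.ne']
    refine h1.trans ?_
    have h2 := hb2 n
    unfold finiteLqNorm at h2
    have h3 : (0 : ℝ) ≤ ∑ i ∈ (b n).support, ‖b n i‖ ^ q :=
      Finset.sum_nonneg fun _ _ => by positivity
    have h4 := Real.rpow_le_rpow (by positivity) h2 hq.le
    rwa [← Real.rpow_mul h3, one_div_mul_cancel hq.ne', Real.rpow_one] at h4
  have hfin2 : ∑ i ∈ a.support, ‖a i‖ ^ q ≤ (C * ‖x‖) ^ q := by
    refine le_of_tendsto' (x := Filter.atTop) (tendsto_finsetSum _ fun i _ => ?_) hfin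
    exact ((hlim i).norm).rpow_const (Or.inr hq.le)
  have h5 := Real.rpow_le_rpow (Finset.sum_nonneg fun _ _ => by positivity) hfin2
    (by positivity : 0 ≤ 1 / q)
  rwa [← Real.rpow_mul (by positivity), mul_one_div_cancel hq.ne', Real.rpow_one] at h5

end Abstract

/-! ### Lattice sums with the weight `1 + |m|^t + |n|^r` -/

/-- The index `n` stands for the lattice point `n + 1` and is charged to the cell `[n + 1, n + 2]`.
`D` absorbs the variation over a cell, and the substitution `x ↦ a * x` produces the exact power of
the scale `a`. -/
theorem sum_le_integral_Ioi {f : ℕ → ℝ} {k : ℝ → ℝ} {D a : ℝ} (ha : 0 < a) (hD : 0 ≤ D)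
    (hf : ∀ n, 0 ≤ f n) (hk : ∀ x, 0 ≤ k x) (hki : IntegrableOn k (Set.Ioi 0))
    (hle : ∀ n : ℕ, ∀ x ∈ Set.Icc ((n : ℝ) + 1) (n + 2), f n ≤ D * k (a * x)) :
    Summable f ∧ ∑' n, f n ≤ D * (a⁻¹ * ∫ x in Set.Ioi 0, k x) := by
  have hki2 : IntegrableOn (fun x => k (a * x)) (Set.Ioi 0) := by
    have := (integrableOn_Ioi_comp_mul_left_iff k 0 ha).2 (by simpa using hki)
    exact this
  have hint : ∫ x in Set.Ioi 0, k (a * x) = a⁻¹ * ∫ x in Set.Ioi 0, k x := by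
    have := integral_comp_mul_left_Ioi k 0 ha
    simpa using this
  have hii : ∀ u v : ℝ, 0 ≤ u → u ≤ v → IntervalIntegrable (fun x => k (a * x)) volume u v := by
    intro u v hu huv
    rw [intervalIntegrable_iff_integrableOn_Ioc_of_le huv]
    exact hki2.mono_set fun x hx => lt_of_le_of_lt hu hx.1
  have hpart : ∀ N : ℕ, ∑ n ∈ Finset.range N, f n ≤ D * (a⁻¹ * ∫ x in Set.Ioi 0, k x) := by
    intro N
    have h1 : ∀ n : ℕ, f n ≤ ∫ x in ((n : ℝ) + 1)..((n + 1 : ℕ) : ℝ) + 1, D * k (a * x) := by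
      intro n
      have hi := hii ((n : ℝ) + 1) (((n + 1 : ℕ) : ℝ) + 1) (by positivity) (by push_cast; linarith)
      have := intervalIntegral.integral_mono_on (a := (n : ℝ) + 1) (b := ((n + 1 : ℕ) : ℝ) + 1)
        (f := fun _ => f n) (μ := volume) (by push_cast; linarith) (by simp) (hi.const_mul D)
        (fun x hx => hle n x ⟨hx.1, by have := hx.2; push_cast at this; linarith⟩)
      simpa using this
    calc ∑ n ∈ Finset.range N, f n
        ≤ ∑ n ∈ Finset.range N,
            ∫ x in ((n : ℝ) + 1)..((n + 1 : ℕ) : ℝ) + 1, D * k (a * x) :=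
          Finset.sum_le_sum fun n _ => h1 n
      _ = ∫ x in (((0 : ℕ) : ℝ) + 1)..((N : ℝ) + 1), D * k (a * x) := by
          rw [intervalIntegral.sum_integral_adjacent_intervals (a := fun n : ℕ => (n : ℝ) + 1)]
          intro n _
          exact (hii _ _ (by positivity) (by push_cast; linarith)).const_mul D
      _ = D * ∫ x in (((0 : ℕ) : ℝ) + 1)..((N : ℝ) + 1), k (a * x) := by
          rw [intervalIntegral.integral_const_mul]
      _ ≤ D * ∫ x in Set.Ioi 0, k (a * x) := by
          gcongr
          rw [intervalIntegral.integral_of_le (by simp)]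
          refine setIntegral_mono_set hki2 (Filter.Eventually.of_forall fun x => hk _) ?_
          refine (LE.le.eventuallyLE fun x hx => ?_)
          have := hx.1
          simp only [Nat.cast_zero, zero_add] at this
          exact lt_trans one_pos this
      _ = _ := by rw [hint]
  exact ⟨summable_of_sum_range_le hf hpart, Real.tsum_le_of_sum_range_le hf hpart⟩

theorem tsum_int_le_of_even {f : ℤ → ℝ} (hneg : ∀ n, f (-n) = f n) {B : ℝ}
    (hs : Summable fun n : ℕ => f (n + 1)) (hB : ∑' n : ℕ, f (n + 1) ≤ B) :
    Summable f ∧ ∑' n, f n ≤ f 0 + 2 * B := by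
  have hs0 : Summable fun n : ℕ => f n := by
    rw [← summable_nat_add_iff 1]
    simpa using hs
  have hs1 : Summable fun n : ℕ => f (-(n + 1)) := by simpa only [hneg] using hs
  refine ⟨Summable.of_nat_of_neg_add_one hs0 hs1, ?_⟩
  rw [tsum_of_nat_of_neg_add_one hs0 hs1, hs0.tsum_eq_zero_add]
  simp only [hneg, Nat.cast_zero, Nat.cast_add, Nat.cast_one]
  linarith

theorem integrableOn_one_div_one_add_rpow {r : ℝ} (hr : 1 < r) :
    IntegrableOn (fun u : ℝ => 1 / (1 + |u| ^ r)) (Set.Ioi 0) := by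
  have hm : Measurable fun u : ℝ => 1 / (1 + |u| ^ r) := by fun_prop
  rw [← Set.Ioc_union_Ioi_eq_Ioi (zero_le_one (α := ℝ))]
  refine IntegrableOn.union ?_ ?_
  · refine Measure.integrableOn_of_bounded (M := 1) (by simp) hm.aestronglyMeasurable ?_
    refine Filter.Eventually.of_forall fun u => ?_
    rw [Real.norm_of_nonneg (by positivity), div_le_one (by positivity)]
    have : 0 ≤ |u| ^ r := by positivity
    linarith
  · refine Integrable.mono' (integrableOn_Ioi_rpow_of_lt (neg_lt_neg hr) one_pos)
      hm.aestronglyMeasurable ?_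
    refine (ae_restrict_iff' measurableSet_Ioi).2 (Filter.Eventually.of_forall fun u hu => ?_)
    have hu0 : 0 < u := lt_trans one_pos hu
    rw [Real.norm_of_nonneg (by positivity), abs_of_pos hu0, Real.rpow_neg hu0.le, one_div]
    gcongr
    linarith

theorem integrableOn_min_sq_mul_rpow {s : ℝ} (h1 : 1 < s) (h3 : s < 3) :
    IntegrableOn (fun u : ℝ => (min 1 |u|) ^ 2 * |u| ^ (-s)) (Set.Ioi 0) := by
  have hm : Measurable fun u : ℝ => (min 1 |u|) ^ 2 * |u| ^ (-s) := by fun_prop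
  rw [← Set.Ioc_union_Ioi_eq_Ioi (zero_le_one (α := ℝ))]
  refine IntegrableOn.union ?_ ?_
  · have hi : IntegrableOn (fun u : ℝ => u ^ (2 - s)) (Set.Ioc 0 1) := by
      rw [← intervalIntegrable_iff_integrableOn_Ioc_of_le zero_le_one]
      exact intervalIntegral.intervalIntegrable_rpow' (by linarith)
    refine Integrable.mono' hi hm.aestronglyMeasurable ?_
    refine (ae_restrict_iff' measurableSet_Ioc).2 (Filter.Eventually.of_forall fun u hu => ?_)
    have hu0 : 0 < u := hu.1
    rw [Real.norm_of_nonneg (by positivity), abs_of_pos hu0, min_eq_right hu.2, sub_eq_add_neg,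
      Real.rpow_add hu0]
    norm_num
  · refine Integrable.mono' (integrableOn_Ioi_rpow_of_lt (neg_lt_neg h1) one_pos)
      hm.aestronglyMeasurable ?_
    refine (ae_restrict_iff' measurableSet_Ioi).2 (Filter.Eventually.of_forall fun u hu => ?_)
    have hu0 : 0 < u := lt_trans one_pos hu
    rw [Real.norm_of_nonneg (by positivity), abs_of_pos hu0, min_eq_left (le_of_lt hu)]
    simp

/-- At scale `n ~ M^(1/r)` the summand is `M⁻¹` times a fixed integrable profile, hence the order
`M⁻¹ * M^(1/r)`. The term `n = 0` fits because `M ≥ 1`; the factor `2^r` comes from `x ≤ 2(n + 1)`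
on a cell. -/
theorem exists_tsum_one_div_add_rpow_le {r : ℝ} (hr : 1 < r) :
    ∃ C : ℝ, 0 < C ∧ ∀ M : ℝ, 1 ≤ M → (Summable fun n : ℤ => 1 / (M + |(n : ℝ)| ^ r)) ∧
      ∑' n : ℤ, 1 / (M + |(n : ℝ)| ^ r) ≤ C * M ^ (1 / r - 1) := by
  set k : ℝ → ℝ := fun u => 1 / (1 + |u| ^ r) with hk
  set K := ∫ u in Set.Ioi 0, k u with hK
  have hK0 : 0 ≤ K := integral_nonneg fun u => by simp only [hk]; positivity
  refine ⟨1 + 2 * (2 ^ r * K), by positivity, fun M hM => ?_⟩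
  have hM0 : 0 < M := by linarith
  have hr0 : 0 < r := by linarith
  have ha : 0 < (M ^ (1 / r))⁻¹ := by positivity
  have hcmp := sum_le_integral_Ioi (f := fun n : ℕ => 1 / (M + |((n + 1 : ℤ) : ℝ)| ^ r)) (k := k)
    (D := 2 ^ r * M⁻¹) ha (by positivity) (fun n => by positivity)
    (fun x => by simp only [hk]; positivity) (integrableOn_one_div_one_add_rpow hr) ?_
  · have h := tsum_int_le_of_even (f := fun n : ℤ => 1 / (M + |(n : ℝ)| ^ r))
      (fun n => by simp) hcmp.1 hcmp.2
    refine ⟨h.1, h.2.trans ?_⟩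
    have e1 : M ^ (1 / r - 1) = M⁻¹ * M ^ (1 / r) := by
      rw [Real.rpow_sub hM0, Real.rpow_one]; field_simp
    have e2 : 1 / (M + |((0 : ℤ) : ℝ)| ^ r) ≤ M ^ (1 / r - 1) := by
      rw [e1]
      simp only [Int.cast_zero, abs_zero, Real.zero_rpow hr0.ne', add_zero, one_div]
      have : 1 ≤ M ^ (r⁻¹) := Real.one_le_rpow hM (by positivity)
      exact le_mul_of_one_le_right (by positivity) this
    refine (add_le_add_left e2 _).trans (le_of_eq ?_)
    rw [e1, inv_inv]
    ring
  · intro n x hx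
    have hx0 : 0 < x := lt_of_lt_of_le (by positivity) hx.1
    have hn1 : (0 : ℝ) < n + 1 := by positivity
    simp only [hk]
    rw [abs_of_pos (by positivity), abs_of_pos (by positivity), Real.mul_rpow (by positivity)
      hx0.le, Real.inv_rpow (by positivity), ← Real.rpow_mul hM0.le,
      one_div_mul_cancel hr0.ne', Real.rpow_one]
    have h2 : x ^ r ≤ 2 ^ r * ((n : ℝ) + 1) ^ r := by
      rw [← Real.mul_rpow (by norm_num) hn1.le]
      exact Real.rpow_le_rpow hx0.le (by linarith [hx.2, (Nat.cast_nonneg n : (0 : ℝ) ≤ n)]) hr0.le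
    have h3 : (1 : ℝ) ≤ 2 ^ r := Real.one_le_rpow (by norm_num) hr0.le
    have h4 : 2 ^ r * M⁻¹ * (1 / (1 + M⁻¹ * x ^ r)) = 2 ^ r / (M + x ^ r) := by
      field_simp
    rw [h4, div_le_div_iff₀ (by positivity) (by positivity)]
    push_cast
    nlinarith [mul_le_mul_of_nonneg_right h3 hM0.le]

/-- The summand is `a^s` times the profile `min(1, u)² u^(-s)` at `u = |m| a`. It is integrable at
`0` because `s < 3` and at infinity because `s > 1`. The term `m = 0` vanishes through the minimum.
-/
theorem exists_tsum_min_sq_mul_rpow_le {s : ℝ} (h1 : 1 < s) (h3 : s < 3) :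
    ∃ C : ℝ, 0 < C ∧ ∀ a : ℝ, 0 < a →
      (Summable fun m : ℤ => (min 1 (|(m : ℝ)| * a)) ^ 2 * |(m : ℝ)| ^ (-s)) ∧
      ∑' m : ℤ, (min 1 (|(m : ℝ)| * a)) ^ 2 * |(m : ℝ)| ^ (-s) ≤ C * a ^ (s - 1) := by
  set k : ℝ → ℝ := fun u => (min 1 |u|) ^ 2 * |u| ^ (-s) with hk
  set K := ∫ u in Set.Ioi 0, k u with hK
  have hK0 : 0 ≤ K := integral_nonneg fun u => by simp only [hk]; positivity
  refine ⟨1 + 2 * (2 ^ s * K), by positivity, fun a ha => ?_⟩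
  have hcmp := sum_le_integral_Ioi
    (f := fun m : ℕ => (min 1 (|((m + 1 : ℤ) : ℝ)| * a)) ^ 2 * |((m + 1 : ℤ) : ℝ)| ^ (-s)) (k := k)
    (D := 2 ^ s * a ^ s) ha (by positivity) (fun n => by positivity)
    (fun x => by simp only [hk]; positivity) (integrableOn_min_sq_mul_rpow h1 h3) ?_
  · have h := tsum_int_le_of_even
      (f := fun m : ℤ => (min 1 (|(m : ℝ)| * a)) ^ 2 * |(m : ℝ)| ^ (-s))
      (fun n => by simp) hcmp.1 hcmp.2
    refine ⟨h.1, h.2.trans ?_⟩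
    have e1 : a ^ (s - 1) = a ^ s * a⁻¹ := by
      rw [Real.rpow_sub ha, Real.rpow_one]; rfl
    rw [e1]
    have : 0 ≤ a ^ s * a⁻¹ := by positivity
    simp only [Int.cast_zero, abs_zero, zero_mul]
    norm_num
    linarith
  · intro n x hx
    have hx0 : 0 < x := lt_of_lt_of_le (by positivity) hx.1
    have hn1 : (0 : ℝ) < n + 1 := by positivity
    simp only [hk]
    rw [abs_of_pos (by positivity), abs_of_pos (by positivity), Real.mul_rpow ha.le hx0.le,
      Real.rpow_neg ha.le, show (2 : ℝ) ^ s * a ^ s * (min 1 (a * x) ^ 2 * ((a ^ s)⁻¹ * x ^ (-s)))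
        = min 1 (a * x) ^ 2 * (2 ^ s * x ^ (-s)) by field_simp]
    have h2 : x ^ s ≤ 2 ^ s * ((n : ℝ) + 1) ^ s := by
      rw [← Real.mul_rpow (by norm_num) hn1.le]
      exact Real.rpow_le_rpow hx0.le (by linarith [hx.2, (Nat.cast_nonneg n : (0 : ℝ) ≤ n)])
        (by linarith)
    push_cast
    refine mul_le_mul ?_ ?_ (by positivity) (by positivity)
    · have : ((n : ℝ) + 1) * a ≤ a * x := by nlinarith [hx.1]
      gcongr
    · rw [Real.rpow_neg hn1.le, Real.rpow_neg hx0.le, ← div_eq_mul_inv, ← one_div,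
        div_le_div_iff₀ (by positivity) (by positivity)]
      linarith

theorem exists_tsum_mul_div_weight_le {r : ℝ} (hr : 1 < r) (t : ℝ) :
    ∃ C : ℝ, 0 < C ∧ ∀ φ : ℤ → ℝ, (∀ m, 0 ≤ φ m) →
      (Summable fun m : ℤ => φ m * (1 + |(m : ℝ)| ^ t) ^ (1 / r - 1)) →
      (Summable fun p : ℤ × ℤ => φ p.1 / (1 + |(p.1 : ℝ)| ^ t + |(p.2 : ℝ)| ^ r)) ∧
      ∑' p : ℤ × ℤ, φ p.1 / (1 + |(p.1 : ℝ)| ^ t + |(p.2 : ℝ)| ^ r)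
        ≤ C * ∑' m : ℤ, φ m * (1 + |(m : ℝ)| ^ t) ^ (1 / r - 1) := by
  obtain ⟨C, hC, h⟩ := exists_tsum_one_div_add_rpow_le hr
  refine ⟨C, hC, fun φ hφ hs => ?_⟩
  have hM : ∀ m : ℤ, (1 : ℝ) ≤ 1 + |(m : ℝ)| ^ t := fun m => by
    have : 0 ≤ |(m : ℝ)| ^ t := by positivity
    linarith
  have hrow : ∀ m : ℤ, Summable fun n : ℤ => φ m / (1 + |(m : ℝ)| ^ t + |(n : ℝ)| ^ r) :=
    fun m => by simpa [div_eq_mul_inv] using (h _ (hM m)).1.mul_left (φ m)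
  have hrowle : ∀ m : ℤ, ∑' n : ℤ, φ m / (1 + |(m : ℝ)| ^ t + |(n : ℝ)| ^ r)
      ≤ C * (φ m * (1 + |(m : ℝ)| ^ t) ^ (1 / r - 1)) := fun m => by
    have := mul_le_mul_of_nonneg_left (h _ (hM m)).2 (hφ m)
    rw [← tsum_mul_left] at this
    simp only [mul_one_div] at this
    linarith
  have hnn : ∀ p : ℤ × ℤ, 0 ≤ φ p.1 / (1 + |(p.1 : ℝ)| ^ t + |(p.2 : ℝ)| ^ r) :=
    fun p => div_nonneg (hφ _) (by positivity)
  have hsum : Summable fun p : ℤ × ℤ => φ p.1 / (1 + |(p.1 : ℝ)| ^ t + |(p.2 : ℝ)| ^ r) := by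
    rw [summable_prod_of_nonneg hnn]
    refine ⟨hrow, ?_⟩
    exact Summable.of_nonneg_of_le (fun m => tsum_nonneg fun n => hnn (m, n)) hrowle
      (hs.mul_left C)
  refine ⟨hsum, ?_⟩
  rw [hsum.tsum_prod, ← tsum_mul_left]
  exact hsum.prod.tsum_le_tsum hrowle (hs.mul_left C)

theorem one_add_rpow_le_rpow {r t : ℝ} (hr : 1 < r) {m : ℤ} (hm : m ≠ 0) :
    (1 + |(m : ℝ)| ^ t) ^ (1 / r - 1) ≤ |(m : ℝ)| ^ (-(t * (1 - 1 / r))) := by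
  have hm0 : 0 < |(m : ℝ)| := by positivity
  have hr1 : 1 / r < 1 := by rw [div_lt_one (by linarith)]; exact hr
  rw [show -(t * (1 - 1 / r)) = t * (1 / r - 1) by ring, Real.rpow_mul hm0.le]
  exact Real.rpow_le_rpow_of_nonpos (by positivity) (by linarith) (by linarith)

/-- Summing over the second index leaves the decay `|m|^(-t(1 - 1/r))`; the two bounds on `t(1 -
1/r)` are then the convergence conditions for the scaled sum over `m`. -/
theorem exists_tsum_min_sq_div_weight_le {r t : ℝ} (hr : 1 < r)
    (h1 : 1 < t * (1 - 1 / r)) (h3 : t * (1 - 1 / r) < 3) :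
    ∃ C : ℝ, 0 < C ∧ ∀ a : ℝ, 0 < a →
      (Summable fun p : ℤ × ℤ =>
        (min 1 (|(p.1 : ℝ)| * a)) ^ 2 / (1 + |(p.1 : ℝ)| ^ t + |(p.2 : ℝ)| ^ r)) ∧
      ∑' p : ℤ × ℤ, (min 1 (|(p.1 : ℝ)| * a)) ^ 2 / (1 + |(p.1 : ℝ)| ^ t + |(p.2 : ℝ)| ^ r)
        ≤ C * a ^ (t * (1 - 1 / r) - 1) := by
  obtain ⟨C, hC, h⟩ := exists_tsum_mul_div_weight_le hr t
  obtain ⟨D, hD, h'⟩ := exists_tsum_min_sq_mul_rpow_le h1 h3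
  refine ⟨C * D, by positivity, fun a ha => ?_⟩
  have hle : ∀ m : ℤ, (min 1 (|(m : ℝ)| * a)) ^ 2 * (1 + |(m : ℝ)| ^ t) ^ (1 / r - 1)
      ≤ (min 1 (|(m : ℝ)| * a)) ^ 2 * |(m : ℝ)| ^ (-(t * (1 - 1 / r))) := by
    intro m
    by_cases hm : m = 0
    · subst hm; simp
    · gcongr
      exact one_add_rpow_le_rpow hr hm
  have hs := Summable.of_nonneg_of_le (fun m => by positivity) hle (h' a ha).1
  have := h (fun m => (min 1 (|(m : ℝ)| * a)) ^ 2) (fun m => by positivity) hs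
  refine ⟨this.1, this.2.trans ?_⟩
  rw [mul_assoc]
  gcongr
  exact (hs.tsum_le_tsum hle (h' a ha).1).trans (h' a ha).2

theorem summable_one_div_weight {r t : ℝ} (hr : 1 < r) (h1 : 1 < t * (1 - 1 / r)) :
    Summable fun p : ℤ × ℤ => 1 / (1 + |(p.1 : ℝ)| ^ t + |(p.2 : ℝ)| ^ r) := by
  obtain ⟨C, hC, h⟩ := exists_tsum_mul_div_weight_le hr t
  refine (h (fun _ => 1) (fun _ => zero_le_one) ?_).1
  have hs : Summable fun m : ℤ => |(m : ℝ)| ^ (-(t * (1 - 1 / r))) := by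
    simpa using Real.summable_abs_int_rpow h1
  refine Summable.of_norm_bounded_eventually hs ?_
  rw [Filter.eventually_cofinite]
  refine (Set.finite_singleton (0 : ℤ)).subset fun m hm => ?_
  by_contra hm0
  apply hm
  rw [one_mul, Real.norm_of_nonneg (by positivity)]
  exact one_add_rpow_le_rpow hr hm0

theorem summable_norm_of_weight {r t : ℝ} (hr : 1 < r) (h1 : 1 < t * (1 - 1 / r))
    {c : ℤ × ℤ → ℂ}
    (hc : Summable fun p => ‖c p‖ ^ 2 * (1 + |(p.1 : ℝ)| ^ t + |(p.2 : ℝ)| ^ r)) :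
    Summable fun p => ‖c p‖ := by
  refine Summable.of_nonneg_of_le (fun p => norm_nonneg _) (fun p => ?_)
    (hc.add (summable_one_div_weight hr h1))
  have hw : 0 < 1 + |(p.1 : ℝ)| ^ t + |(p.2 : ℝ)| ^ r := by positivity
  set w := 1 + |(p.1 : ℝ)| ^ t + |(p.2 : ℝ)| ^ r
  -- Completing the square gives `‖c‖ ≤ ‖c‖² w + 1/w`, and both terms on the right are summable.
  have h2 : ‖c p‖ ^ 2 * w + 1 / w - ‖c p‖ = ((‖c p‖ * w - 1 / 2) ^ 2 + 3 / 4) / w := by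
    field_simp; ring
  have h3 : 0 ≤ ((‖c p‖ * w - 1 / 2) ^ 2 + 3 / 4) / w := by positivity
  linarith

theorem tsum_mul_le_sqrt_mul_sqrt {ι : Type*} {f g : ι → ℝ} (hf : ∀ i, 0 ≤ f i)
    (hg : ∀ i, 0 ≤ g i) (hf2 : Summable fun i => f i ^ 2) (hg2 : Summable fun i => g i ^ 2) :
    (Summable fun i => f i * g i) ∧
      ∑' i, f i * g i ≤ √(∑' i, f i ^ 2) * √(∑' i, g i ^ 2) := by
  have h := Real.inner_le_Lp_mul_Lq_tsum_of_nonneg (p := 2) (q := 2)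
    (by constructor <;> norm_num) hf hg (by simpa using hf2) (by simpa using hg2)
  refine ⟨?_, by simpa [Real.sqrt_eq_rpow] using h⟩
  exact Real.summable_mul_of_Lp_Lq_of_nonneg (p := 2) (q := 2) (by constructor <;> norm_num) hf hg
    (by simpa using hf2) (by simpa using hg2)

/-- Cauchy–Schwarz against the weight gives the right power of `ε`. Splitting off finitely many
terms, which are of higher order, makes the remaining weighted sum as small as desired and turns a
bound `O` into `o`; the critical case needs exactly this gain. -/
theorem tsum_norm_mul_min_isLittleO {r t : ℝ} (hr : 1 < r) (ht : 0 < t)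
    (h1 : 1 < t * (1 - 1 / r)) (h3 : t * (1 - 1 / r) < 3) {c : ℤ × ℤ → ℂ}
    (hc : Summable fun p => ‖c p‖ ^ 2 * (1 + |(p.1 : ℝ)| ^ t + |(p.2 : ℝ)| ^ r))
    {δ : ℝ} (hδ : 0 < δ) :
    ∀ᶠ ε in nhdsWithin (0 : ℝ) (Set.Ioi 0),
      ∑' p, ‖c p‖ * min 1 (|(p.1 : ℝ)| * ε ^ (2 / t)) ≤ δ * ε ^ (1 - 1 / r - 1 / t) := by
  classical
  obtain ⟨C, hC, h⟩ := exists_tsum_min_sq_div_weight_le hr h1 h3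
  have hcs := summable_norm_of_weight hr h1 hc
  set w : ℤ × ℤ → ℝ := fun p => 1 + |(p.1 : ℝ)| ^ t + |(p.2 : ℝ)| ^ r with hw
  have hw0 : ∀ p, 0 < w p := fun p => by simp only [hw]; positivity
  -- a finite set outside of which the weighted sum is small
  obtain ⟨T, hT⟩ : ∃ T : Finset (ℤ × ℤ),
      ∑' p, (if p ∈ T then 0 else ‖c p‖ ^ 2 * w p) < (δ / 2) ^ 2 / C := by
    have ht := tendsto_tsum_compl_atTop_zero fun p => ‖c p‖ ^ 2 * w p
    obtain ⟨T, hT⟩ := (ht.eventually (gt_mem_nhds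
      (show (0 : ℝ) < (δ / 2) ^ 2 / C by positivity))).exists
    refine ⟨T, ?_⟩
    have hi : (fun p => if p ∈ T then 0 else ‖c p‖ ^ 2 * w p)
        = {p | p ∉ T}.indicator fun p => ‖c p‖ ^ 2 * w p := by
      funext p
      by_cases hp : p ∈ T <;> simp [hp]
    rw [hi, ← tsum_subtype]
    exact hT
  -- The finite part is linear in `ε^(2/t)`; `e` is the surplus over the target exponent, positive
  -- exactly when `t(1 - 1/r) < 3`.
  set e : ℝ := 2 / t - (1 - 1 / r - 1 / t) with he
  have he0 : 0 < e := by
    have : e * t = 3 - t * (1 - 1 / r) := by rw [he]; field_simp; ring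
    by_contra hcon
    nlinarith
  set K := ∑ p ∈ T, ‖c p‖ * |(p.1 : ℝ)| with hK
  have hlim : Filter.Tendsto (fun ε : ℝ => K * ε ^ e) (nhdsWithin 0 (Set.Ioi 0)) (nhds 0) := by
    have : Filter.Tendsto (fun ε : ℝ => K * ε ^ e) (nhds 0) (nhds (K * 0 ^ e)) :=
      (Real.continuousAt_rpow_const 0 e (Or.inr he0.le)).const_mul K |>.tendsto
    rw [Real.zero_rpow he0.ne', mul_zero] at this
    exact this.mono_left nhdsWithin_le_nhds
  filter_upwards [hlim.eventually (gt_mem_nhds (half_pos hδ)), self_mem_nhdsWithin] with ε hε hε0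
  rw [Set.mem_Ioi] at hε0
  set a := ε ^ (2 / t) with ha
  have ha0 : 0 < a := by positivity
  set u : ℤ × ℤ → ℝ := fun p => min 1 (|(p.1 : ℝ)| * a) with hu
  have hu0 : ∀ p, 0 ≤ u p := fun p => le_min zero_le_one (by positivity)
  have hsu : Summable fun p => ‖c p‖ * u p :=
    Summable.of_nonneg_of_le (fun p => mul_nonneg (norm_nonneg _) (hu0 p))
      (fun p => mul_le_of_le_one_right (norm_nonneg _) (min_le_left _ _)) hcs
  have hsplit : ∀ p, ‖c p‖ * u p = (if p ∈ T then ‖c p‖ * u p else 0)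
      + (if p ∈ T then 0 else ‖c p‖ * √(w p)) * (u p / √(w p)) := by
    intro p
    have := Real.sqrt_pos.2 (hw0 p)
    split_ifs
    · simp
    · field_simp; ring
  have hsT : Summable fun p => if p ∈ T then ‖c p‖ * u p else 0 :=
    summable_of_ne_finset_zero (s := T) fun p hp => by simp [hp]
  have hsq1 : ∀ p, (if p ∈ T then 0 else ‖c p‖ * √(w p)) ^ 2
      = if p ∈ T then 0 else ‖c p‖ ^ 2 * w p := by
    intro p
    split_ifs
    · simp
    · rw [mul_pow, Real.sq_sqrt (hw0 p).le]
  have hsq2 : ∀ p, (u p / √(w p)) ^ 2 = u p ^ 2 / w p := by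
    intro p; rw [div_pow, Real.sq_sqrt (hw0 p).le]
  have hcs2 := tsum_mul_le_sqrt_mul_sqrt (f := fun p => if p ∈ T then 0 else ‖c p‖ * √(w p))
    (g := fun p => u p / √(w p)) (fun p => by split_ifs <;> positivity)
    (fun p => div_nonneg (hu0 p) (Real.sqrt_nonneg _))
    (by
      simp only [hsq1]
      refine Summable.of_nonneg_of_le (fun p => ?_) (fun p => ?_) hc
      · have := (hw0 p).le
        split_ifs <;> positivity
      · have := (hw0 p).le
        split_ifs
        · exact mul_nonneg (by positivity) this
        · exact le_rfl)
    (by simp only [hsq2]; exact (h a ha0).1)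
  simp only [hsq1, hsq2] at hcs2
  have hpow : a ^ (t * (1 - 1 / r) - 1) = (ε ^ (1 - 1 / r - 1 / t)) ^ 2 := by
    rw [ha, ← Real.rpow_mul hε0.le, ← Real.rpow_natCast, ← Real.rpow_mul hε0.le]
    congr 1
    field_simp
    ring
  calc ∑' p, ‖c p‖ * u p
      = ∑' p, ((if p ∈ T then ‖c p‖ * u p else 0)
        + (if p ∈ T then 0 else ‖c p‖ * √(w p)) * (u p / √(w p))) := tsum_congr hsplit
    _ = ∑ p ∈ T, ‖c p‖ * u p
        + ∑' p, (if p ∈ T then 0 else ‖c p‖ * √(w p)) * (u p / √(w p)) := by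
        rw [hsT.tsum_add hcs2.1, tsum_eq_sum (s := T) (fun p hp => by simp [hp])]
        congr 1
        exact Finset.sum_congr rfl fun p hp => by simp [hp]
    _ ≤ K * a + √((δ / 2) ^ 2 / C) * √(C * (ε ^ (1 - 1 / r - 1 / t)) ^ 2) := by
        refine add_le_add ?_ (hcs2.2.trans ?_)
        · rw [hK, Finset.sum_mul]
          refine Finset.sum_le_sum fun p _ => ?_
          rw [mul_assoc]
          exact mul_le_mul_of_nonneg_left (min_le_right _ _) (norm_nonneg _)
        · refine mul_le_mul (Real.sqrt_le_sqrt hT.le) (Real.sqrt_le_sqrt ?_)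
            (Real.sqrt_nonneg _) (Real.sqrt_nonneg _)
          rw [← hpow]
          exact (h a ha0).2
    _ = K * ε ^ e * ε ^ (1 - 1 / r - 1 / t) + δ / 2 * ε ^ (1 - 1 / r - 1 / t) := by
        congr 1
        · rw [mul_assoc, ← Real.rpow_add hε0, ha, he]; congr 2; ring
        · rw [← Real.sqrt_mul (by positivity), show (δ / 2) ^ 2 / C * (C * (ε ^ (1 - 1 / r - 1 / t)) ^ 2)
            = (δ / 2 * ε ^ (1 - 1 / r - 1 / t)) ^ 2 by field_simp, Real.sqrt_sq (by positivity)]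
    _ ≤ δ * ε ^ (1 - 1 / r - 1 / t) := by
        rw [← add_mul]
        gcongr
        linarith

/-! ### Zeros of quasi-periodic functions -/

theorem exp_arg_div_mul (z w : ℂ) (hz : z ≠ 0) (hw : w ≠ 0) :
    Complex.exp ((w / z).arg * Complex.I) * (z / ‖z‖) = w / ‖w‖ := by
  have h1 := Complex.norm_mul_exp_arg_mul_I (w / z)
  have hz' : (‖z‖ : ℂ) ≠ 0 := by simpa using hz
  have hw' : (‖w‖ : ℂ) ≠ 0 := by simpa using hw
  rw [norm_div, Complex.ofReal_div] at h1
  have h2 : Complex.exp ((w / z).arg * Complex.I) = w / z / (‖w‖ / ‖z‖) := by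
    rw [eq_div_iff (div_ne_zero hw' hz'), mul_comm]; exact h1
  rw [h2]
  field_simp

/-- The phases of successive quotients telescope. If the chain closes up, their sum is a multiple of
`2π`. -/
theorem exp_sum_arg_div (u : ℕ → ℂ) (hu : ∀ i, u i ≠ 0) (n : ℕ) :
    Complex.exp (((∑ i ∈ Finset.range n, (u (i + 1) / u i).arg : ℝ) : ℂ) * Complex.I)
      * (u 0 / ‖u 0‖) = u n / ‖u n‖ := by
  induction n with
  | zero => simp
  | succ n ih =>
    rw [Finset.sum_range_succ, Complex.ofReal_add, add_mul, add_comm, Complex.exp_add, mul_assoc, ih,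
      exp_arg_div_mul _ _ (hu n) (hu (n + 1))]

theorem re_div_pos_of_norm_sub_lt {z w : ℂ} (h : ‖w - z‖ < ‖z‖) : 0 < (w / z).re := by
  have hz : z ≠ 0 := by
    rintro rfl
    simp at h
    exact absurd h (not_lt.2 (norm_nonneg _))
  have h1 : ‖w / z - 1‖ < 1 := by
    rw [div_sub_one hz, norm_div, div_lt_one (norm_pos_iff.2 hz)]
    exact h
  have h2 := (Complex.abs_re_le_norm (w / z - 1)).trans_lt h1
  rw [Complex.sub_re, Complex.one_re, abs_lt] at h2
  linarith

/-- The arguments lie in `[0, π/2]` and `(-π/2, π/2)`, so their sum stays within the principal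
branch. -/
theorem arg_unitExp_mul {s : ℝ} (hs0 : 0 ≤ s) (hs : s ≤ 1 / 4) {z : ℂ} (hz : 0 < z.re) :
    (unitExp s * z).arg = 2 * Real.pi * s + z.arg := by
  have hpi := Real.pi_pos
  have h0 : z ≠ 0 := by rintro rfl; simp at hz
  have h1 : (unitExp s).arg = 2 * Real.pi * s := by
    rw [unitExp_eq, Complex.arg_exp_mul_I, toIocMod_eq_self]
    constructor <;> nlinarith
  have h2 := abs_lt.1 (Complex.abs_arg_lt_pi_div_two_iff.2 (Or.inl hz))
  rw [← h1]
  refine Complex.arg_mul (unitExp_ne_zero s) h0 ?_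
  rw [h1]
  constructor <;> nlinarith

/-- A continuous quasi-periodic function on the plane has a zero. -/
theorem exists_zero_of_quasiperiodic {F : ℝ → ℝ → ℂ} (hF : Continuous (Function.uncurry F))
    (hy : ∀ x y, F x (y + 1) = F x y) (hx : ∀ x y, F (x + 1) y = unitExp y * F x y) :
    ∃ x y, F x y = 0 := by
  by_contra! hne
  set Q : Set (ℝ × ℝ) := Set.Icc 0 1 ×ˢ Set.Icc 0 1 with hQ
  have hQc : IsCompact Q := isCompact_Icc.prod isCompact_Icc
  obtain ⟨p, hpQ, hp⟩ := hQc.exists_isMinOn ⟨(0, 0), by simp [hQ]⟩ hF.norm.continuousOn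
  set δ := ‖Function.uncurry F p‖ with hδ
  have hδ0 : 0 < δ := norm_pos_iff.2 (hne _ _)
  have huc := Metric.uniformContinuousOn_iff.1 (hQc.uniformContinuousOn_of_continuous hF.continuousOn)
  obtain ⟨η, hη, huc⟩ := huc δ hδ0
  -- `1 / N < η` keeps consecutive quotients in the right half-plane; `N > 4` makes `1 / N`
  -- admissible in `arg_unitExp_mul`.
  obtain ⟨N, hN⟩ := exists_nat_gt (max 4 (1 / η))
  have hN4 : (4 : ℝ) < N := (le_max_left _ _).trans_lt hN
  have hN0 : (0 : ℝ) < N := by linarith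
  have hNη : 1 / (N : ℝ) < η := by
    rw [div_lt_comm₀ hN0 hη]; exact (le_max_right _ _).trans_lt hN
  set ρ : ℕ → ℝ → ℂ := fun i x => F x ((i + 1 : ℕ) / N) / F x (i / N) with hρ
  have hre : ∀ i, i < N → ∀ x ∈ Set.Icc (0 : ℝ) 1, 0 < (ρ i x).re := by
    intro i hi x hx
    have hi1 : ((i : ℝ) + 1) ≤ N := by exact_mod_cast hi
    have hm1 : (x, (i / N : ℝ)) ∈ Q :=
      ⟨hx, by positivity, by rw [div_le_one hN0]; linarith⟩
    have hm2 : (x, ((i + 1 : ℕ) / N : ℝ)) ∈ Q :=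
      ⟨hx, by positivity, by rw [div_le_one hN0]; push_cast; linarith⟩
    apply re_div_pos_of_norm_sub_lt
    have h1 := huc _ hm2 _ hm1 (by
      rw [Prod.dist_eq, dist_self, Real.dist_eq, ← sub_div, max_lt_iff]
      refine ⟨hη, ?_⟩
      push_cast
      rw [add_sub_cancel_left, abs_of_pos (by positivity)]
      exact hNη)
    rw [dist_eq_norm] at h1
    exact h1.trans_le (hp hm1)
  -- `S x` is the total change of phase of `F x ·` over one period: continuous in `x` and, by
  -- periodicity, a multiple of `2π`.
  set S : ℝ → ℝ := fun x => ∑ i ∈ Finset.range N, (ρ i x).arg with hS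
  have hScont : ContinuousOn S (Set.Icc 0 1) := by
    refine continuousOn_finsetSum _ fun i hi => ?_
    intro x hx
    refine ContinuousAt.continuousWithinAt ?_
    refine ContinuousAt.comp (f := ρ i) (Complex.continuousAt_arg (Or.inl (hre i (by simpa using hi) x hx))) ?_
    have h1 : ∀ y : ℝ, Continuous fun x => F x y := fun y => hF.comp (f := fun x => (x, y)) (by fun_prop)
    exact (h1 _).continuousAt.div (h1 _).continuousAt (hne _ _)
  have hSexp : ∀ x, Complex.exp ((S x : ℂ) * Complex.I) = 1 := by
    intro x
    have h1 := exp_sum_arg_div (fun i => F x ((i : ℕ) / N)) (fun i => hne _ _) N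
    have h2 : F x ((N : ℕ) / N) = F x (((0 : ℕ) : ℝ) / N) := by
      rw [div_self hN0.ne', Nat.cast_zero, zero_div, ← hy x 0, zero_add]
    simp only [h2] at h1
    have h3 : F x (((0 : ℕ) : ℝ) / N) / ‖F x (((0 : ℕ) : ℝ) / N)‖ ≠ 0 :=
      div_ne_zero (hne _ _) (by simpa using hne _ _)
    exact mul_right_cancel₀ h3 (by rw [one_mul]; exact h1)
  -- Quasi-periodicity multiplies each of the `N` quotients by `e^(2πi/N)`, so the winding number
  -- changes by one.
  have hS1 : S 1 = S 0 + 2 * Real.pi := by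
    have h1 : ∀ i ∈ Finset.range N, (ρ i 1).arg = 2 * Real.pi * (1 / N) + (ρ i 0).arg := by
      intro i hi
      rw [← arg_unitExp_mul (by positivity)
        (by rw [div_le_div_iff₀ hN0 (by norm_num)]; linarith)
        (hre i (by simpa using hi) 0 (by simp))]
      congr 1
      have h2 := hx 0 ((i + 1 : ℕ) / N)
      have h3 := hx 0 (i / N)
      rw [zero_add] at h2 h3
      simp only [hρ]
      rw [h2, h3, show ((i + 1 : ℕ) / N : ℝ) = 1 / N + i / N by push_cast; ring, unitExp_add]
      have := unitExp_ne_zero ((i : ℝ) / N)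
      have := hne 0 ((i : ℝ) / N)
      field_simp
    simp only [hS]
    rw [Finset.sum_congr rfl h1, Finset.sum_add_distrib]
    simp
    field_simp
    ring
  -- A continuous `S` would take the value `S 0 + π`, where the exponential is `-1` instead of `1`.
  have hivt := intermediate_value_Icc zero_le_one hScont
  obtain ⟨x, -, hxS⟩ := hivt (show S 0 + Real.pi ∈ _ from
    ⟨by linarith [Real.pi_pos], by rw [hS1]; linarith [Real.pi_pos]⟩)
  have h1 := hSexp x
  rw [hxS, Complex.ofReal_add, add_mul, Complex.exp_add, hSexp 0, Complex.exp_pi_mul_I] at h1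
  norm_num at h1

/-! ### The Zak transform and norms of Gabor sums -/

/-- The Zak transform `∑ₙ G(x - n) e^{2πiny}`. -/
def zakSum (G : ℝ → ℂ) (x y : ℝ) : ℂ := ∑' n : ℤ, G (x - n) * unitExp (n * y)

/-- The trigonometric polynomial with coefficients `A m`, `m ∈ s`. -/
def trigSum (s : Finset ℤ) (A : ℤ → ℂ) (x : ℝ) : ℂ := ∑ m ∈ s, A m * unitExp (m * x)

theorem continuous_trigSum (s : Finset ℤ) (A : ℤ → ℂ) : Continuous (trigSum s A) :=
  continuous_finsetSum _ fun _ _ => continuous_const.mul (continuous_unitExp.comp (by fun_prop))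

theorem unitExp_add_int (x : ℝ) (p : ℤ) : unitExp (x + p) = unitExp x := by
  rw [unitExp_add, unitExp_intCast, mul_one]

theorem unitExp_mul_add_int (m : ℤ) (x : ℝ) (p : ℤ) :
    unitExp (m * (x + p)) = unitExp (m * x) := by
  rw [mul_add, ← Int.cast_mul, unitExp_add_int]

theorem trigSum_add_int (s : Finset ℤ) (A : ℤ → ℂ) (x : ℝ) (p : ℤ) :
    trigSum s A (x + p) = trigSum s A x := by
  simp only [trigSum, unitExp_mul_add_int]

theorem summable_mul_unitExp {ι : Type*} {d : ι → ℂ} (hd : Summable d) (φ : ι → ℝ) :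
    Summable fun i => d i * unitExp (φ i) := by
  refine Summable.of_norm ?_
  simpa using hd.norm

theorem zakSum_add_one_right (G : ℝ → ℂ) (x y : ℝ) : zakSum G x (y + 1) = zakSum G x y := by
  unfold zakSum
  refine tsum_congr fun n => ?_
  rw [← unitExp_mul_add_int n y 1, Int.cast_one]

theorem zakSum_add_one_left (G : ℝ → ℂ) (x y : ℝ) :
    zakSum G (x + 1) y = unitExp y * zakSum G x y := by
  unfold zakSum
  rw [← (Equiv.addRight (1 : ℤ)).tsum_eq, ← tsum_mul_left]
  refine tsum_congr fun n => ?_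
  simp only [Equiv.coe_addRight]
  rw [show x + 1 - ((n + 1 : ℤ) : ℝ) = x - n by push_cast; ring,
    show ((n + 1 : ℤ) : ℝ) * y = y + n * y by push_cast; ring, unitExp_add]
  ring

/-- In `p` the sum is a correlation of `B` with the samples of `G`. Its Fourier series is the
product of `trigSum s B (-y)` and the Zak transform, and Parseval applies; the sign of `y` comes
from the correlation. -/
theorem hasSum_sq_norm_shift_sum {G : ℝ → ℂ} {x : ℝ} (hG : Summable fun n : ℤ => G (x - n))
    (s : Finset ℤ) (B : ℤ → ℂ) :
    HasSum (fun p : ℤ => ‖∑ n ∈ s, B n * G (x - (p + n))‖ ^ 2)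
      (∫ y in (0 : ℝ)..0 + 1, ‖trigSum s B (-y) * zakSum G x y‖ ^ 2) := by
  have hshift : ∀ n : ℤ, Summable fun p : ℤ => G (x - (p + n)) := fun n => by
    have := (Equiv.addRight n).summable_iff.2 hG
    simpa [Function.comp_def] using this
  have hd : Summable fun p : ℤ => ∑ n ∈ s, B n * G (x - (p + n)) :=
    summable_sum fun n _ => (hshift n).mul_left _
  have h := hasSum_sq_norm_of_summable hd
  convert h using 4 with y
  congr 1
  have h1 : ∀ n : ℤ, HasSum (fun p : ℤ => G (x - (p + n)) * unitExp (p * y))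
      (unitExp (-(n * y)) * zakSum G x y) := by
    intro n
    have h2 : HasSum (fun k : ℤ => G (x - k) * unitExp (k * y)) (zakSum G x y) :=
      (summable_mul_unitExp hG _).hasSum
    have h3 := ((Equiv.addRight n).hasSum_iff.2 h2).mul_left (unitExp (-(n * y)))
    refine (congrArg (HasSum · _) (funext fun p => ?_)).mp h3
    simp only [Function.comp, Equiv.coe_addRight, Int.cast_add]
    rw [show (p : ℝ) * y = -(n * y) + (p + n) * y by ring, unitExp_add]
    ring
  have h4 := hasSum_sum fun n (_ : n ∈ s) => (h1 n).mul_left (B n)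
  rw [show (∑' p : ℤ, (∑ n ∈ s, B n * G (x - (p + n))) * unitExp (p * y))
    = ∑ n ∈ s, B n * (unitExp (-(n * y)) * zakSum G x y) from ?_]
  · rw [trigSum, Finset.sum_mul]
    refine Finset.sum_congr rfl fun n _ => ?_
    rw [mul_neg]; ring
  · rw [← h4.tsum_eq]
    refine tsum_congr fun p => ?_
    rw [Finset.sum_mul]
    exact Finset.sum_congr rfl fun n _ => by ring

theorem norm_sq_eq_integral (h : Lp ℂ 2 (volume : Measure ℝ)) :
    ‖h‖ ^ 2 = ∫ x, ‖h x‖ ^ 2 := by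
  have h1 := L2.integral_inner_eq_sq_eLpNorm (𝕜 := ℂ) h
  have h2 : ((∫ x, ‖h x‖ ^ 2 : ℝ) : ℂ) = ((‖h‖ ^ 2 : ℝ) : ℂ) := by
    rw [← integral_complex_ofReal]
    have h3 := inner_self_eq_norm_sq_to_K (𝕜 := ℂ) h
    rw [L2.inner_def] at h3
    push_cast
    simp only [inner_self_eq_norm_sq_to_K] at h3
    exact h3
  exact_mod_cast h2.symm

theorem gaborSystem_sum_ae {g : Lp ℂ 2 (volume : Measure ℝ)} {G : ℝ → ℂ} (hgG : g =ᵐ[volume] G)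
    (s s' : Finset ℤ) (A B : ℤ → ℂ) :
    (∑ p ∈ s ×ˢ s', (A p.1 * B p.2) • gaborSystem g p : Lp ℂ 2 (volume : Measure ℝ))
      =ᵐ[volume] fun x => trigSum s A x * ∑ n ∈ s', B n * G (x - n) := by
  have h1 : ∀ p : ℤ × ℤ, ((A p.1 * B p.2) • gaborSystem g p : Lp ℂ 2 (volume : Measure ℝ))
      =ᵐ[volume] fun x => A p.1 * unitExp (p.1 * x) * (B p.2 * G (x - p.2)) := by
    intro p
    have h2 : (fun x => g (x - p.2)) =ᵐ[volume] fun x => G (x - p.2) :=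
      (measurePreserving_sub_right volume (p.2 : ℝ)).quasiMeasurePreserving.ae_eq_comp hgG
    filter_upwards [Lp.coeFn_smul (A p.1 * B p.2) (gaborSystem g p),
      (memLp_gaborFun g p.1 p.2).coeFn_toLp, h2] with x hx1 hx2 hx3
    rw [hx1, Pi.smul_apply, gaborSystem, hx2, gaborFun, hx3, unitExp, smul_eq_mul]
    rw [show (2 * Real.pi * Complex.I * p.1 * x : ℂ)
      = 2 * Real.pi * Complex.I * ((p.1 * x : ℝ) : ℂ) by push_cast; ring]
    ring
  have h3 : ∀ᵐ x, ∀ p : ℤ × ℤ, ((A p.1 * B p.2) • gaborSystem g p : Lp ℂ 2 (volume : Measure ℝ)) x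
      = A p.1 * unitExp (p.1 * x) * (B p.2 * G (x - p.2)) := ae_all_iff.2 h1
  filter_upwards [Lp.coeFn_finsetSum (s ×ˢ s') fun p => (A p.1 * B p.2) • gaborSystem g p, h3]
    with x hx1 hx2
  rw [hx1, Finset.sum_apply, Finset.sum_congr rfl fun p _ => hx2 p, trigSum, Finset.sum_mul_sum,
    Finset.sum_product]

/-- The line is cut into unit intervals and folded onto one; the factor in `A` is periodic and comes
out, and the rest is summed by `hasSum_sq_norm_shift_sum`. As only an inequality is needed, finite
partial sums over the intervals suffice. -/
theorem norm_sq_gaborSystem_sum_le {g : Lp ℂ 2 (volume : Measure ℝ)} {G : ℝ → ℂ}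
    (hgG : g =ᵐ[volume] G) (hGc : Continuous G) (hG : ∀ x, Summable fun n : ℤ => G (x - n))
    (hF : Continuous (Function.uncurry (zakSum G)))
    (s s' : Finset ℤ) (A B : ℤ → ℂ) (a : ℝ) :
    ‖∑ p ∈ s ×ˢ s', (A p.1 * B p.2) • gaborSystem g p‖ ^ 2
      ≤ ∫ x in a..a + 1, ‖trigSum s A x‖ ^ 2 *
          ∫ y in (0 : ℝ)..0 + 1, ‖trigSum s' B (-y) * zakSum G x y‖ ^ 2 := by
  set h := ∑ p ∈ s ×ˢ s', (A p.1 * B p.2) • gaborSystem g p with hh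
  set Φ : ℝ → ℝ := fun x => ‖trigSum s A x * ∑ n ∈ s', B n * G (x - n)‖ ^ 2 with hΦ
  have hae := gaborSystem_sum_ae hgG s s' A B
  have hae2 : (fun x => ‖h x‖ ^ 2) =ᵐ[volume] Φ := by
    filter_upwards [hae] with x hx
    simp only [hΦ]
    rw [hh, hx]
  have hint : Integrable Φ := ((memLp_two_iff_integrable_sq_norm (Lp.memLp h).1).1
    (Lp.memLp h)).congr hae2
  have hΦc : Continuous Φ := by
    refine ((continuous_trigSum s A).mul (continuous_finsetSum _ fun n _ => ?_)).norm.pow 2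
    exact continuous_const.mul (hGc.comp (by fun_prop))
  have hJc : Continuous fun x => ‖trigSum s A x‖ ^ 2 *
      ∫ y in (0 : ℝ)..0 + 1, ‖trigSum s' B (-y) * zakSum G x y‖ ^ 2 := by
    refine ((continuous_trigSum s A).norm.pow 2).mul ?_
    apply intervalIntegral.continuous_parametric_intervalIntegral_of_continuous'
    refine (((continuous_trigSum s' B).comp (by fun_prop)).mul ?_).norm.pow 2
    exact hF
  rw [norm_sq_eq_integral, integral_congr_ae hae2]
  have hsum := hint.hasSum_intervalIntegral a
  refine le_of_tendsto' hsum fun P => ?_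
  have hshift : ∀ p : ℤ, ∫ x in a + p..a + p + 1, Φ x = ∫ x in a..a + 1, Φ (x + p) := by
    intro p
    rw [intervalIntegral.integral_comp_add_right]
    congr 1; ring
  rw [Finset.sum_congr rfl fun p _ => hshift p, ← intervalIntegral.integral_finsetSum]
  swap
  · intro p _
    exact (hΦc.comp (by fun_prop : Continuous fun x : ℝ => x + (p : ℝ))).intervalIntegrable _ _
  refine intervalIntegral.integral_mono_on (by linarith) ?_ (hJc.intervalIntegrable _ _) ?_
  · refine Continuous.intervalIntegrable ?_ _ _
    exact continuous_finsetSum _ fun p _ => hΦc.comp (by fun_prop)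
  · intro x _
    have h1 := hasSum_sq_norm_shift_sum (hG x) s' B
    have h2 : ∀ p : ℤ, Φ (x + p)
        = ‖trigSum s A x‖ ^ 2 * ‖∑ n ∈ s', B n * G (x - ((-p : ℤ) + n))‖ ^ 2 := by
      intro p
      simp only [hΦ]
      rw [trigSum_add_int, norm_mul, mul_pow]
      congr 4
      funext n
      congr 2
      push_cast
      ring
    rw [Finset.sum_congr rfl fun p _ => h2 p]
    have h3 := ((Equiv.neg ℤ).hasSum_iff.2 h1).mul_left (‖trigSum s A x‖ ^ 2)
    exact sum_le_hasSum P (fun p _ => by positivity) h3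

/-- The norm bound for an exact `(C_q)` Gabor system, in terms of the Zak transform. -/
theorem IsExactCqSystem.exists_trigSum_bound {q : ℝ} (hq : 0 < q)
    {g : Lp ℂ 2 (volume : Measure ℝ)} (hg : IsExactCqSystem q (gaborSystem g)) {G : ℝ → ℂ}
    (hgG : g =ᵐ[volume] G) (hGc : Continuous G) (hG : ∀ x, Summable fun n : ℤ => G (x - n))
    (hF : Continuous (Function.uncurry (zakSum G))) :
    ∃ C : ℝ, 0 < C ∧ ∀ (s s' : Finset ℤ) (A B : ℤ → ℂ) (a : ℝ),
      (∑ m ∈ s, ‖A m‖ ^ q) ^ (1 / q) * (∑ n ∈ s', ‖B n‖ ^ q) ^ (1 / q)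
        ≤ C * √(∫ x in a..a + 1, ‖trigSum s A x‖ ^ 2 *
          ∫ y in (0 : ℝ)..0 + 1, ‖trigSum s' B (-y) * zakSum G x y‖ ^ 2) := by
  classical
  obtain ⟨C, hC, h⟩ := hg.2.finiteLqNorm_le hq hg.1.2
  refine ⟨C, hC, fun s s' A B a => ?_⟩
  have h1 := h (Finsupp.indicator (s ×ˢ s') fun p _ => A p.1 * B p.2)
  have hval : ∀ p ∈ s ×ˢ s', Finsupp.indicator (s ×ˢ s') (fun p _ => A p.1 * B p.2) p
      = A p.1 * B p.2 := fun p hp => Finsupp.indicator_of_mem hp _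
  have hsub := Finsupp.support_indicator_subset (s ×ˢ s') fun p _ => A p.1 * B p.2
  have h2 : ∑ j ∈ (Finsupp.indicator (s ×ˢ s') fun p _ => A p.1 * B p.2).support,
      (Finsupp.indicator (s ×ˢ s') fun p _ => A p.1 * B p.2) j • gaborSystem g j
      = ∑ p ∈ s ×ˢ s', (A p.1 * B p.2) • gaborSystem g p := by
    rw [Finset.sum_subset hsub fun p _ hp => by rw [Finsupp.notMem_support_iff.1 hp, zero_smul]]
    exact Finset.sum_congr rfl fun p hp => by rw [hval p hp]
  -- For product coefficients the `ℓ^q` norm factors.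
  have h3 : finiteLqNorm q (Finsupp.indicator (s ×ˢ s') fun p _ => A p.1 * B p.2)
      = (∑ m ∈ s, ‖A m‖ ^ q) ^ (1 / q) * (∑ n ∈ s', ‖B n‖ ^ q) ^ (1 / q) := by
    unfold finiteLqNorm
    rw [Finset.sum_subset hsub fun p _ hp => by
      rw [Finsupp.notMem_support_iff.1 hp, norm_zero, Real.zero_rpow hq.ne'],
      ← Real.mul_rpow (Finset.sum_nonneg fun _ _ => by positivity)
        (Finset.sum_nonneg fun _ _ => by positivity), Finset.sum_mul_sum, Finset.sum_product]
    congr 1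
    refine Finset.sum_congr rfl fun m hm => Finset.sum_congr rfl fun n hn => ?_
    rw [hval (m, n) (Finset.mk_mem_product hm hn), norm_mul,
      Real.mul_rpow (norm_nonneg _) (norm_nonneg _)]
  rw [h2, h3] at h1
  refine h1.trans ?_
  gcongr
  exact Real.le_sqrt_of_sq_le (norm_sq_gaborSystem_sum_le hgG hGc hG hF s s' A B a)

/-! ### Localized trigonometric polynomials with large coefficients -/

theorem SchwartzMap.exists_norm_le_div_one_add_abs_pow (f : 𝓢(ℝ, ℂ)) (k : ℕ) :
    ∃ C : ℝ, 0 < C ∧ ∀ x, ‖f x‖ ≤ C / (1 + |x|) ^ k := by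
  have h := fun x => SchwartzMap.one_add_le_sup_seminorm_apply (𝕜 := ℝ) (m := (k, 0)) le_rfl le_rfl
    f x
  refine ⟨2 ^ k * ((Finset.Iic (k, 0)).sup fun m => SchwartzMap.seminorm ℝ m.1 m.2) f + 1,
    by positivity, fun x => ?_⟩
  have h1 := h x
  rw [norm_iteratedFDeriv_zero] at h1
  rw [le_div_iff₀ (by positivity), mul_comm]
  simp only [Real.norm_eq_abs] at h1
  linarith

theorem SchwartzMap.summable_int (f : 𝓢(ℝ, ℂ)) : Summable fun n : ℤ => f n :=
  summable_of_isBigO (Real.summable_abs_int_rpow one_lt_two)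
    ((f.isBigO_cocompact_rpow (-2)).comp_tendsto Int.tendsto_coe_cofinite)

theorem Real.fourier_eq_integral_unitExp (f : ℝ → ℂ) (w : ℝ) :
    𝓕 f w = ∫ v, unitExp (-(v * w)) * f v := by
  rw [Real.fourier_real_eq_integral_exp_smul]
  refine integral_congr_ae (Filter.Eventually.of_forall fun v => ?_)
  simp only [smul_eq_mul, unitExp]
  congr 2
  push_cast
  ring

/-- A fixed smooth bump on `[-1, 1]`, as a complex valued function. -/
def stdBump (x : ℝ) : ℂ := ((⟨1 / 2, 1, by norm_num, by norm_num⟩ : ContDiffBump (0 : ℝ)) x : ℝ)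

theorem contDiff_stdBump : ContDiff ℝ ∞ stdBump :=
  Complex.ofRealCLM.contDiff.comp (ContDiffBump.contDiff _)

theorem norm_stdBump_le (x : ℝ) : ‖stdBump x‖ ≤ 1 := by
  rw [stdBump, Complex.norm_real, Real.norm_of_nonneg (ContDiffBump.nonneg _)]
  exact ContDiffBump.le_one _

theorem stdBump_eq_zero {x : ℝ} (hx : 1 ≤ |x|) : stdBump x = 0 := by
  rw [stdBump, ContDiffBump.zero_of_le_dist _ (by simpa [Real.dist_eq] using hx)]
  simp

theorem integral_stdBump_ne_zero : ∫ x, stdBump x ≠ 0 := by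
  unfold stdBump
  rw [integral_complex_ofReal]
  exact_mod_cast (ContDiffBump.integral_pos _).ne'

theorem hasCompactSupport_stdBump : HasCompactSupport stdBump :=
  HasCompactSupport.intro (isCompact_Icc (a := (-1 : ℝ)) (b := 1)) fun x hx => by
    apply stdBump_eq_zero
    by_contra h
    exact hx (abs_le.1 (not_le.1 h).le)

theorem hasCompactSupport_scaled_stdBump {a : ℝ} (ha : 0 < a) (x₀ : ℝ) :
    HasCompactSupport fun x => stdBump ((x - x₀) / a) :=
  HasCompactSupport.intro (isCompact_Icc (a := x₀ - a) (b := x₀ + a)) fun x hx => by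
    apply stdBump_eq_zero
    by_contra h
    rw [not_le, abs_div, abs_of_pos ha, div_lt_one ha, abs_lt] at h
    exact hx ⟨by linarith, by linarith⟩

/-- The dilated and translated bump `x ↦ κ((x - x₀)/a)`. -/
def scaledBump (a : ℝ) (ha : 0 < a) (x₀ : ℝ) : 𝓢(ℝ, ℂ) :=
  (hasCompactSupport_scaled_stdBump ha x₀).toSchwartzMap
    (contDiff_stdBump.comp (by fun_prop : ContDiff ℝ ∞ fun x : ℝ => (x - x₀) / a))

theorem norm_fourier_scaledBump {a : ℝ} (ha : 0 < a) (x₀ w : ℝ) :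
    ‖𝓕 (scaledBump a ha x₀) w‖ = a * ‖∫ v, unitExp (-(v * (a * w))) * stdBump v‖ := by
  have h1 : 𝓕 (scaledBump a ha x₀) w
      = ∫ v, unitExp (-(v * w)) * stdBump ((v - x₀) / a) := by
    rw [SchwartzMap.fourier_coe, Real.fourier_eq_integral_unitExp]
    rfl
  have h2 := integral_sub_right_eq_self (μ := (volume : Measure ℝ))
    (fun v => unitExp (-((v + x₀) * w)) * stdBump (v / a)) x₀
  simp only [sub_add_cancel] at h2
  have h3 := Measure.integral_comp_div
    (fun v => unitExp (-((v * a + x₀) * w)) * stdBump v) a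
  simp only [div_mul_cancel₀ _ ha.ne'] at h3
  rw [h1, h2, h3, norm_smul, Real.norm_eq_abs, abs_abs, abs_of_pos ha]
  congr 1
  have h4 : ∀ v, unitExp (-((v * a + x₀) * w)) * stdBump v
      = unitExp (-(x₀ * w)) * (unitExp (-(v * (a * w))) * stdBump v) := by
    intro v
    rw [show -((v * a + x₀) * w) = -(x₀ * w) + -(v * (a * w)) by ring, unitExp_add]
    ring
  simp_rw [h4]
  rw [integral_const_mul, norm_mul, norm_unitExp, one_mul]

theorem exists_norm_fourier_stdBump_ge :
    ∃ c s : ℝ, 0 < c ∧ 0 < s ∧ ∀ w, |w| ≤ s →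
      c ≤ ‖∫ v, unitExp (-(v * w)) * stdBump v‖ := by
  set f : 𝓢(ℝ, ℂ) := 𝓕 (hasCompactSupport_stdBump.toSchwartzMap contDiff_stdBump) with hf
  have hfv : ∀ w, f w = ∫ v, unitExp (-(v * w)) * stdBump v := by
    intro w
    rw [hf, SchwartzMap.fourier_coe, Real.fourier_eq_integral_unitExp]
    rfl
  have h0 : 0 < ‖f 0‖ := by
    rw [hfv]
    simpa using integral_stdBump_ne_zero
  have hev := (f.continuous.norm.continuousAt (x := 0)).eventually (lt_mem_nhds (half_lt_self h0))
  obtain ⟨s, hs, hs2⟩ := Metric.eventually_nhds_iff.1 hev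
  refine ⟨‖f 0‖ / 2, s / 2, by positivity, by positivity, fun w hw => ?_⟩
  rw [← hfv]
  exact (hs2 (by rw [Real.dist_eq, sub_zero]; linarith)).le

theorem tsum_scaledBump {a : ℝ} (ha : 0 < a) (ha2 : a < 1 / 2) {x₀ x : ℝ} (hx : |x - x₀| ≤ 1 / 2) :
    ∑' n : ℤ, scaledBump a ha x₀ (x + n) = stdBump ((x - x₀) / a) := by
  rw [tsum_eq_single 0]
  · simp [scaledBump]
  · intro n hn
    change stdBump ((x + n - x₀) / a) = 0
    apply stdBump_eq_zero
    rw [abs_div, abs_of_pos ha, le_div_iff₀ ha, one_mul]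
    have h1 : (1 : ℝ) ≤ |(n : ℝ)| := by exact_mod_cast Int.one_le_abs hn
    have h2 : |(n : ℝ)| ≤ |x + n - x₀| + |x - x₀| := by
      have := abs_sub (x + n - x₀) (x - x₀)
      rwa [show x + n - x₀ - (x - x₀) = n by ring] at this
    linarith

/-- At least `s / a` coefficients have size at least `a * c`, which gives the order `(a⁻¹ a^q)^(1/q)
= a^(1 - 1/q)`. -/
theorem rpow_le_sum_Icc {q : ℝ} (hq : 0 < q) {s c a : ℝ} (hs : 0 < s) (hc : 0 < c) (ha : 0 < a)
    {A : ℤ → ℂ} (hA : ∀ m : ℤ, |a * m| ≤ s → a * c ≤ ‖A m‖) {S : Finset ℤ}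
    (hS : Finset.Icc (-⌊s / a⌋) ⌊s / a⌋ ⊆ S) :
    s ^ (1 / q) * c * a ^ (1 - 1 / q) ≤ (∑ m ∈ S, ‖A m‖ ^ q) ^ (1 / q) := by
  have hfl : 0 ≤ ⌊s / a⌋ := Int.floor_nonneg.2 (by positivity)
  have h1 : s / a * (a * c) ^ q ≤ ∑ m ∈ S, ‖A m‖ ^ q := by
    refine le_trans ?_ (Finset.sum_le_sum_of_subset_of_nonneg hS fun _ _ _ => by positivity)
    have h2 : ∑ m ∈ Finset.Icc (-⌊s / a⌋) ⌊s / a⌋, (a * c) ^ q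
        ≤ ∑ m ∈ Finset.Icc (-⌊s / a⌋) ⌊s / a⌋, ‖A m‖ ^ q := by
      refine Finset.sum_le_sum fun m hm => Real.rpow_le_rpow (by positivity) (hA m ?_) hq.le
      rw [Finset.mem_Icc, ← abs_le] at hm
      have h3 : |(m : ℝ)| ≤ s / a :=
        le_trans (by exact_mod_cast hm) (Int.floor_le (s / a))
      rw [abs_mul, abs_of_pos ha, mul_comm]
      rwa [le_div_iff₀ ha] at h3
    refine le_trans ?_ h2
    rw [Finset.sum_const, nsmul_eq_mul, Int.card_Icc]
    gcongr
    have h4 := Int.lt_floor_add_one (s / a)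
    have h5 : (((⌊s / a⌋ + 1 - -⌊s / a⌋).toNat : ℤ) : ℝ) = 2 * ⌊s / a⌋ + 1 := by
      rw [Int.toNat_of_nonneg (by linarith)]; push_cast; ring
    rw [Int.cast_natCast] at h5
    rw [h5]
    have : (0 : ℝ) ≤ ⌊s / a⌋ := by exact_mod_cast hfl
    linarith
  refine le_trans (le_of_eq ?_) (Real.rpow_le_rpow (by positivity) h1 (by positivity))
  rw [Real.mul_rpow (by positivity) (by positivity), ← Real.rpow_mul (by positivity),
    mul_one_div_cancel hq.ne', Real.rpow_one, Real.div_rpow hs.le ha.le, Real.rpow_sub ha,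
    Real.rpow_one]
  field_simp

/-- Trigonometric polynomials that are close to a bump of width `a` at `x₀`, with large
coefficients. -/
theorem exists_trigSum_localized {q : ℝ} (hq : 0 < q) :
    ∃ c : ℝ, 0 < c ∧ ∀ a : ℝ, 0 < a → a < 1 / 2 → ∀ x₀ η : ℝ, 0 < η →
      ∃ (s : Finset ℤ) (A : ℤ → ℂ),
        c * a ^ (1 - 1 / q) ≤ (∑ m ∈ s, ‖A m‖ ^ q) ^ (1 / q) ∧
        (∀ x, |x - x₀| ≤ 1 / 2 → ‖trigSum s A x‖ ≤ 1 + η) ∧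
        (∀ x, |x - x₀| ≤ 1 / 2 → a ≤ |x - x₀| → ‖trigSum s A x‖ ≤ η) := by
  obtain ⟨c, σ, hc, hσ, hcσ⟩ := exists_norm_fourier_stdBump_ge
  refine ⟨σ ^ (1 / q) * c, by positivity, fun a ha ha2 x₀ η hη => ?_⟩
  set A : ℤ → ℂ := fun m => 𝓕 (scaledBump a ha x₀) m with hA
  have hAs : Summable A := (𝓕 (scaledBump a ha x₀)).summable_int
  -- `s` makes the tail smaller than `η`; the frequencies `|m| ≤ σ / a` are adjoined to secure the
  -- lower bound on the coefficients.
  obtain ⟨s, hs⟩ := summable_iff_vanishing_norm.1 hAs.norm η hη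
  set S := s ∪ Finset.Icc (-⌊σ / a⌋) ⌊σ / a⌋ with hS
  have hclose : ∀ x, |x - x₀| ≤ 1 / 2 → ‖trigSum S A x - stdBump ((x - x₀) / a)‖ ≤ η := by
    intro x hx
    -- Poisson summation: the full series is the periodized bump, of which only the central
    -- translate is seen within distance `1/2` of `x₀`.
    have h1 := SchwartzMap.tsum_eq_tsum_fourier (scaledBump a ha x₀) x
    have h2 : ∀ n : ℤ, fourier n (x : UnitAddCircle) = unitExp (n * x) := by
      intro n
      rw [fourier_coe_apply, unitExp]; congr 1; push_cast; ring
    rw [tsum_scaledBump ha ha2 hx] at h1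
    simp only [h2] at h1
    have h3 : HasSum (fun n : ℤ => A n * unitExp (n * x)) (stdBump ((x - x₀) / a)) := by
      rw [h1]; exact (summable_mul_unitExp hAs _).hasSum
    have h4 : Filter.Tendsto (fun T => ‖trigSum S A x - trigSum T A x‖) Filter.atTop
        (nhds ‖trigSum S A x - stdBump ((x - x₀) / a)‖) := (h3.const_sub _).norm
    refine le_of_tendsto h4 ?_
    filter_upwards [Filter.eventually_ge_atTop S] with T hT
    rw [norm_sub_rev, trigSum, trigSum, ← Finset.sum_sdiff hT, add_sub_cancel_right]
    refine (norm_sum_le _ _).trans ?_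
    simp only [norm_mul, norm_unitExp, mul_one]
    have h5 := hs (T \ S) (Finset.disjoint_of_subset_right Finset.subset_union_left
      Finset.sdiff_disjoint)
    exact (le_abs_self _).trans h5.le
  refine ⟨S, A, ?_, fun x hx => ?_, fun x hx hx2 => ?_⟩
  · refine rpow_le_sum_Icc hq hσ hc ha (fun m hm => ?_) Finset.subset_union_right
    simp only [hA]
    rw [norm_fourier_scaledBump ha]
    exact mul_le_mul_of_nonneg_left (hcσ _ hm) ha.le
  · have h1 := norm_le_norm_add_norm_sub' (trigSum S A x) (stdBump ((x - x₀) / a))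
    have h2 := norm_stdBump_le ((x - x₀) / a)
    have h3 := hclose x hx
    linarith
  · have h3 := hclose x hx
    rwa [stdBump_eq_zero, sub_zero] at h3
    rwa [abs_div, abs_of_pos ha, le_div_iff₀ ha, one_mul]

/-! ### Moments, continuity, and frequency-side decay -/

theorem one_add_rpow_le {s : ℝ} (hs : 0 ≤ s) {x : ℝ} (hx : 0 ≤ x) :
    (1 + x) ^ s ≤ 2 ^ s * (1 + x ^ s) := by
  have h0 : 0 ≤ x ^ s := by positivity
  rcases le_total x 1 with h | h
  · have h1 : (1 + x) ^ s ≤ 2 ^ s := Real.rpow_le_rpow (by positivity) (by linarith) hs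
    have h2 : (0 : ℝ) ≤ 2 ^ s := by positivity
    nlinarith
  · have h1 : (1 + x) ^ s ≤ (2 * x) ^ s := Real.rpow_le_rpow (by positivity) (by linarith) hs
    rw [Real.mul_rpow (by norm_num) hx] at h1
    have h2 : (0 : ℝ) ≤ 2 ^ s := by positivity
    nlinarith

theorem integrable_weight_of_momentL2 {s : ℝ} (hs : 0 ≤ s) {f : Lp ℂ 2 (volume : Measure ℝ)}
    (h : momentL2 s f ≠ ⊤) : Integrable fun x => (1 + |x|) ^ s * ‖f x‖ ^ 2 := by
  have hf : AEStronglyMeasurable (fun x => ‖f x‖ ^ 2) volume := (Lp.memLp f).1.norm.pow 2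
  have h1 : Integrable fun x : ℝ => |x| ^ s * ‖f x‖ ^ 2 := by
    refine ⟨((by fun_prop : Measurable fun x : ℝ => |x| ^ s).aestronglyMeasurable).mul hf, ?_⟩
    rw [hasFiniteIntegral_iff_ofReal (Filter.Eventually.of_forall fun x => by positivity)]
    exact lt_top_iff_ne_top.2 h
  have h2 : Integrable fun x : ℝ => ‖f x‖ ^ 2 :=
    (memLp_two_iff_integrable_sq_norm (Lp.memLp f).1).1 (Lp.memLp f)
  refine Integrable.mono' ((h2.add h1).const_mul (2 ^ s))
    (((by fun_prop : Measurable fun x : ℝ => (1 + |x|) ^ s).aestronglyMeasurable).mul hf) ?_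
  refine Filter.Eventually.of_forall fun x => ?_
  rw [Real.norm_of_nonneg (by positivity)]
  have := mul_le_mul_of_nonneg_right (one_add_rpow_le hs (abs_nonneg x)) (sq_nonneg ‖f x‖)
  refine this.trans (le_of_eq ?_)
  simp only [Pi.add_apply]
  ring

theorem integrable_of_integrable_weight {s : ℝ} (hs : 1 < s) {f : Lp ℂ 2 (volume : Measure ℝ)}
    (h : Integrable fun x => (1 + |x|) ^ s * ‖f x‖ ^ 2) : Integrable f := by
  have h1 : Integrable fun x : ℝ => (1 + ‖x‖) ^ (-s) :=
    integrable_one_add_norm (by simpa using hs)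
  refine Integrable.mono' (h.add h1) (Lp.memLp f).1 (Filter.Eventually.of_forall fun x => ?_)
  simp only [Pi.add_apply, Real.norm_eq_abs]
  have hw : 0 < (1 + |x|) ^ s := by positivity
  rw [Real.rpow_neg (by positivity)]
  set w := (1 + |x|) ^ s
  -- As for `summable_norm_of_weight`: `‖f‖ ≤ w ‖f‖² + 1/w`.
  have h2 : w * ‖f x‖ ^ 2 + w⁻¹ - ‖f x‖ = ((‖f x‖ * w - 1 / 2) ^ 2 + 3 / 4) / w := by
    field_simp; ring
  have h3 : 0 ≤ ((‖f x‖ * w - 1 / 2) ^ 2 + 3 / 4) / w := by positivity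
  linarith

theorem integral_conj_mul_eq_fourier (u : 𝓢(ℝ, ℂ)) (g : Lp ℂ 2 (volume : Measure ℝ)) :
    ∫ x, conj (u x) * g x = ∫ ξ, conj ((𝓕 u) ξ) * (𝓕 g) ξ := by
  have h := Lp.inner_fourier_eq (u.toLp 2) g
  rw [SchwartzMap.toLp_fourier_eq, L2.inner_def, L2.inner_def] at h
  have h1 : ∫ x, conj (u x) * g x = ∫ x, inner ℂ ((u.toLp 2 : Lp ℂ 2 volume) x) (g x) := by
    refine integral_congr_ae ?_
    filter_upwards [u.coeFn_toLp 2 volume] with x hx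
    rw [hx, RCLike.inner_apply']
  have h2 : ∫ ξ, conj ((𝓕 u) ξ) * (𝓕 g) ξ
      = ∫ x, inner ℂ (((𝓕 u).toLp 2 : Lp ℂ 2 volume) x) ((𝓕 g) x) := by
    refine integral_congr_ae ?_
    filter_upwards [(𝓕 u).coeFn_toLp 2 volume] with x hx
    rw [hx, RCLike.inner_apply']
  rw [h1, h2, h]

theorem conj_unitExp (s : ℝ) : conj (unitExp s) = unitExp (-s) := by
  rw [unitExp_eq, unitExp_eq, ← Complex.exp_conj, map_mul, Complex.conj_ofReal, Complex.conj_I]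
  congr 1
  push_cast
  ring

theorem exists_schwartzMap_eq {f : ℝ → ℂ} (hf : ContDiff ℝ ∞ f) (hc : HasCompactSupport f) :
    ∃ u : 𝓢(ℝ, ℂ), ∀ x, u x = f x :=
  ⟨hc.toSchwartzMap hf, fun _ => rfl⟩

theorem exists_schwartzMap_eq_ofReal {φ : ℝ → ℝ} (hφ : ContDiff ℝ ∞ φ)
    (hc : HasCompactSupport φ) : ∃ u : 𝓢(ℝ, ℂ), ∀ x, u x = φ x :=
  exists_schwartzMap_eq (f := fun x => (φ x : ℂ)) (Complex.ofRealCLM.contDiff.comp hφ)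
    (hc.comp_left (g := fun y : ℝ => (y : ℂ)) (by simp))

/-- An `L²` function with integrable Fourier transform is a.e. equal to a continuous function. -/
theorem exists_continuous_ae_eq {g f : Lp ℂ 2 (volume : Measure ℝ)} (hf : 𝓕 g = f)
    (h : Integrable f) :
    ∃ G : ℝ → ℂ, Continuous G ∧ g =ᵐ[volume] G := by
  set G : ℝ → ℂ := fun x => ∫ ξ, unitExp (x * ξ) * f ξ with hG
  have hGc : Continuous G := by
    refine continuous_of_dominated (bound := fun ξ => ‖f ξ‖) (fun x => ?_) (fun x => ?_) h.norm ?_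
    · exact (continuous_unitExp.comp (by fun_prop)).aestronglyMeasurable.mul h.1
    · exact Filter.Eventually.of_forall fun ξ => by simp
    · refine Filter.Eventually.of_forall fun ξ => ?_
      exact (continuous_unitExp.comp (by fun_prop)).mul continuous_const
  refine ⟨G, hGc, ?_⟩
  -- `g` and `G` are compared on test functions: Plancherel moves the pairing to `f`, and Fubini
  -- brings it back as a pairing with `G`.
  refine ae_eq_of_integral_contDiff_smul_eq
    ((Lp.memLp g).locallyIntegrable (by norm_num)) hGc.locallyIntegrable ?_
  intro φ hφ hφc
  obtain ⟨u, huv⟩ := exists_schwartzMap_eq_ofReal hφ hφc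
  have h1 := integral_conj_mul_eq_fourier u g
  rw [hf] at h1
  simp only [huv, Complex.conj_ofReal] at h1
  simp only [Complex.real_smul]
  rw [h1]
  have h2 : ∀ ξ, conj ((𝓕 u) ξ) = ∫ x, unitExp (x * ξ) * φ x := by
    intro ξ
    rw [SchwartzMap.fourier_coe, Real.fourier_eq_integral_unitExp, ← integral_conj]
    refine integral_congr_ae (Filter.Eventually.of_forall fun x => ?_)
    simp only [map_mul, conj_unitExp, neg_neg, huv, Complex.conj_ofReal]
  simp only [h2, hG, ← integral_const_mul, ← integral_mul_const]
  rw [integral_integral_swap]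
  · refine integral_congr_ae (Filter.Eventually.of_forall fun x => ?_)
    refine integral_congr_ae (Filter.Eventually.of_forall fun ξ => ?_)
    simp only
    ring
  · have h3 : Integrable (fun p : ℝ × ℝ => f p.1 * u p.2) (volume.prod volume) :=
      h.mul_prod u.integrable
    refine (h3.bdd_mul (c := 1) (f := fun p : ℝ × ℝ => unitExp (p.2 * p.1))
      (continuous_unitExp.comp (by fun_prop)).aestronglyMeasurable
      (Filter.Eventually.of_forall fun p => by simp)).congr ?_
    refine Filter.Eventually.of_forall fun p => ?_
    simp only [Function.uncurry, huv]
    ring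

theorem ENNReal.sq_tsum_mul_le {ι : Type*} (a b : ι → ℝ≥0∞) :
    (∑' i, a i * b i) ^ 2 ≤ (∑' i, a i ^ 2) * ∑' i, b i ^ 2 := by
  let _ : MeasurableSpace ι := ⊤
  have h := ENNReal.lintegral_mul_le_Lp_mul_Lq (Measure.count : Measure ι)
    (p := 2) (q := 2) (by constructor <;> norm_num) (f := a) (g := b)
    (measurable_from_top.aemeasurable) (measurable_from_top.aemeasurable)
  simp only [Pi.mul_apply, lintegral_count, ENNReal.rpow_ofNat] at h
  refine (pow_le_pow_left' h 2).trans (le_of_eq ?_)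
  rw [mul_pow, ← ENNReal.rpow_natCast, ← ENNReal.rpow_natCast, ← ENNReal.rpow_mul,
    ← ENNReal.rpow_mul]
  norm_num

theorem tsum_ofReal_one_add_abs_int_ne_top :
    ∑' j : ℤ, ENNReal.ofReal (1 + |(j : ℝ)|)⁻¹ ^ 2 ≠ ⊤ := by
  have hs : Summable fun j : ℤ => ((1 + |(j : ℝ)|)⁻¹) ^ 2 := by
    refine Summable.of_norm_bounded_eventually (g := fun j : ℤ => |(j : ℝ)| ^ (-2 : ℝ))
      (by simpa using Real.summable_abs_int_rpow one_lt_two) ?_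
    rw [Filter.eventually_cofinite]
    refine (Set.finite_singleton (0 : ℤ)).subset fun m hm => ?_
    by_contra hm0
    apply hm
    have hm1 : 0 < |(m : ℝ)| := abs_pos.2 (Int.cast_ne_zero.2 hm0)
    rw [Real.norm_of_nonneg (by positivity), Real.rpow_neg hm1.le, Real.rpow_ofNat, inv_pow]
    gcongr
    linarith
  simp_rw [← ENNReal.ofReal_pow (inv_nonneg.2 (by positivity : (0 : ℝ) ≤ 1 + |((_ : ℤ) : ℝ)|))]
  exact hs.tsum_ofReal_ne_top

theorem one_add_abs_le_mul (a b : ℝ) : 1 + |a| ≤ (1 + |b|) * (1 + |a - b|) := by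
  have h := abs_add_le b (a - b)
  rw [add_sub_cancel] at h
  nlinarith [mul_nonneg (abs_nonneg b) (abs_nonneg (a - b))]

/-- With `d = 1 + |l - m|`, the weight at `m` costs `d^t` times the weight at `ξ`. The decay
`d^(-2k)` of `‖ψ‖²` must pay for this, for the `d²` used in Cauchy–Schwarz, and for a summable
`d^(-2)`: hence `t + 4 ≤ 2k`. -/
theorem weight_mul_sq_norm_le {t D : ℝ} (ht : 0 ≤ t) (hD : 0 ≤ D) {k : ℕ} (hk : t + 4 ≤ 2 * k)
    {l m : ℤ} {ξ : ℝ} (hξ : ξ ∈ Set.Icc (l : ℝ) (l + 1)) {ψ z : ℂ}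
    (hψ : ‖ψ‖ ≤ D / (1 + |ξ - m|) ^ k) :
    (1 + |(m : ℝ)|) ^ t * (1 + |((l - m : ℤ) : ℝ)|) ^ 2 * ‖ψ * z‖ ^ 2
      ≤ 2 ^ t * (D * 2 ^ k) ^ 2 * ((1 + |((l - m : ℤ) : ℝ)|)⁻¹) ^ 2 *
        ((1 + |ξ|) ^ t * ‖z‖ ^ 2) := by
  set d : ℝ := 1 + |((l - m : ℤ) : ℝ)| with hd
  have hd1 : 1 ≤ d := by rw [hd]; linarith [abs_nonneg ((l - m : ℤ) : ℝ)]
  have hd0 : 0 < d := by linarith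
  have hlξ : |(l : ℝ) - ξ| ≤ 1 := abs_le.2 ⟨by linarith [hξ.2], by linarith [hξ.1]⟩
  have h1 : d ≤ 2 * (1 + |ξ - m|) := by
    rw [hd]; push_cast
    have := abs_add_le ((l : ℝ) - ξ) (ξ - m)
    rw [sub_add_sub_cancel] at this
    linarith [abs_nonneg (ξ - m)]
  have h2 : 1 + |(m : ℝ)| ≤ d * (2 * (1 + |ξ|)) := by
    have h3 := one_add_abs_le_mul (m : ℝ) l
    have h4 : 1 + |(l : ℝ)| ≤ 2 * (1 + |ξ|) := by
      have := abs_add_le ((l : ℝ) - ξ) ξ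
      rw [sub_add_cancel] at this
      linarith [abs_nonneg ξ]
    have h5 : 1 + |(m : ℝ) - l| = d := by rw [hd]; push_cast; rw [abs_sub_comm]
    rw [h5] at h3
    nlinarith
  have h3 : (1 + |(m : ℝ)|) ^ t ≤ d ^ t * (2 ^ t * (1 + |ξ|) ^ t) := by
    rw [← Real.mul_rpow (by norm_num) (by positivity), ← Real.mul_rpow hd0.le (by positivity)]
    exact Real.rpow_le_rpow (by positivity) h2 ht
  have h4 : ‖ψ‖ ≤ D * 2 ^ k / d ^ k := by
    refine hψ.trans ?_
    rw [div_le_div_iff₀ (by positivity) (by positivity), mul_assoc, ← mul_pow]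
    gcongr
  have h5 : d ^ t * d ^ 2 * (1 / d ^ k) ^ 2 ≤ (d⁻¹) ^ 2 := by
    have e1 : d ^ t * d ^ 2 * d ^ 2 ≤ (d ^ k) ^ 2 := by
      rw [← pow_mul, ← Real.rpow_natCast d (k * 2), ← Real.rpow_natCast d 2, ← Real.rpow_add hd0,
        ← Real.rpow_add hd0]
      refine Real.rpow_le_rpow_of_exponent_le hd1 ?_
      push_cast
      linarith
    rw [div_pow, one_pow, mul_one_div, inv_pow, ← one_div,
      div_le_div_iff₀ (by positivity) (by positivity), one_mul]
    exact e1
  calc (1 + |(m : ℝ)|) ^ t * d ^ 2 * ‖ψ * z‖ ^ 2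
      ≤ d ^ t * (2 ^ t * (1 + |ξ|) ^ t) * d ^ 2 * ((D * 2 ^ k / d ^ k) * ‖z‖) ^ 2 := by
        rw [norm_mul]; gcongr
    _ = 2 ^ t * (D * 2 ^ k) ^ 2 * (d ^ t * d ^ 2 * (1 / d ^ k) ^ 2) *
        ((1 + |ξ|) ^ t * ‖z‖ ^ 2) := by ring
    _ ≤ _ := by gcongr

/-- The frequency line is cut into unit cells indexed by `l`. On each cell Parseval sums over `n`;
the cells are recombined by Cauchy–Schwarz with weights `1 + |l - m|`. The decay of `Ψ` concentrates
everything near `l = m`, and summing over `m` recovers the moment of `f`. -/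
theorem summable_sq_norm_integral_mul_weight {t : ℝ} (ht : 0 ≤ t)
    {f : Lp ℂ 2 (volume : Measure ℝ)} (hf1 : Integrable f)
    (hf : Integrable fun x => (1 + |x|) ^ t * ‖f x‖ ^ 2) {Ψ : ℝ → ℂ} (hΨc : Continuous Ψ)
    (hΨ : ∀ k : ℕ, ∃ C : ℝ, 0 < C ∧ ∀ x, ‖Ψ x‖ ≤ C / (1 + |x|) ^ k) :
    Summable fun p : ℤ × ℤ =>
      ‖∫ ξ, unitExp (-(p.2 * ξ)) * (Ψ (ξ - p.1) * f ξ)‖ ^ 2 * (1 + |(p.1 : ℝ)|) ^ t := by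
  obtain ⟨k, hk⟩ := exists_nat_ge ((t + 4) / 2)
  obtain ⟨D, hD, hΨD⟩ := hΨ k
  obtain ⟨D₀, hD₀, hΨ₀⟩ := hΨ 0
  have hΨ₀' : ∀ x, ‖Ψ x‖ ≤ D₀ := by simpa using hΨ₀
  set K : ℝ := 2 ^ t * (D * 2 ^ k) ^ 2 with hK
  have hK0 : 0 ≤ K := by positivity
  set U : ℤ → ℝ → ℂ := fun m ξ => Ψ (ξ - m) * f ξ with hU
  have hΨm : ∀ m : ℤ, AEStronglyMeasurable (fun ξ : ℝ => Ψ (ξ - m)) volume := fun m =>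
    (hΨc.comp (by fun_prop)).aestronglyMeasurable
  have hUi : ∀ m, Integrable (U m) := fun m =>
    hf1.bdd_mul (hΨm m) (Filter.Eventually.of_forall fun ξ => hΨ₀' _)
  have hU2 : ∀ m, MemLp (U m) 2 volume := fun m =>
    (Lp.memLp f).of_le_mul (c := D₀) ((hΨm m).mul (Lp.memLp f).1)
      (Filter.Eventually.of_forall fun ξ => by
        simp only [hU, norm_mul]
        exact mul_le_mul_of_nonneg_right (hΨ₀' _) (norm_nonneg _))
  have hE : ∀ (m n : ℤ), Integrable fun ξ => unitExp (-(n * ξ)) * U m ξ := fun m n =>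
    (hUi m).bdd_mul (c := 1) (continuous_unitExp.comp (by fun_prop)).aestronglyMeasurable
      (Filter.Eventually.of_forall fun ξ => by simp)
  set cl : ℤ → ℤ → ℤ → ℂ := fun m n l => ∫ ξ in (l : ℝ)..l + 1, unitExp (-(n * ξ)) * U m ξ with hcl
  have hsum : ∀ m n, HasSum (cl m n) (∫ ξ, unitExp (-(n * ξ)) * U m ξ) := fun m n => by
    simpa only [zero_add] using (hE m n).hasSum_intervalIntegral 0
  set Γ : ℤ → ℝ := fun l => ∫ ξ in (l : ℝ)..l + 1, (1 + |ξ|) ^ t * ‖f ξ‖ ^ 2 with hΓ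
  have hΓs : Summable Γ := by
    have := (hf.hasSum_intervalIntegral 0).summable
    simpa only [zero_add] using this
  have hpar : ∀ m l, HasSum (fun n => ‖cl m n l‖ ^ 2) (∫ ξ in (l : ℝ)..l + 1, ‖U m ξ‖ ^ 2) :=
    fun m l => hasSum_sq_norm_integral_unitExp l ((hU2 m).restrict _)
  have hw : ∀ m l : ℤ, (1 + |(m : ℝ)|) ^ t * (1 + |((l - m : ℤ) : ℝ)|) ^ 2 *
      ∫ ξ in (l : ℝ)..l + 1, ‖U m ξ‖ ^ 2 ≤ K * ((1 + |((l - m : ℤ) : ℝ)|)⁻¹) ^ 2 * Γ l := by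
    intro m l
    simp only [hΓ]
    rw [← intervalIntegral.integral_const_mul, ← intervalIntegral.integral_const_mul]
    refine intervalIntegral.integral_mono_on (by linarith)
      (((memLp_two_iff_integrable_sq_norm (hU2 m).1).1 (hU2 m)).intervalIntegrable.const_mul _)
      (hf.intervalIntegrable.const_mul _) fun ξ hξ => ?_
    exact weight_mul_sq_norm_le ht hD.le (by linarith) hξ (hΨD _)
  set κ : ℝ≥0∞ := ∑' j : ℤ, ENNReal.ofReal (1 + |(j : ℝ)|)⁻¹ ^ 2 with hκ
  have hκt : κ ≠ ⊤ := tsum_ofReal_one_add_abs_int_ne_top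
  set v : ℤ → ℝ≥0∞ := fun j => ENNReal.ofReal (1 + |(j : ℝ)|) with hv
  have hvinv : ∀ j : ℤ, ENNReal.ofReal (1 + |(j : ℝ)|)⁻¹ * v j = 1 := by
    intro j
    simp only [hv]
    rw [← ENNReal.ofReal_mul (by positivity), inv_mul_cancel₀ (by positivity), ENNReal.ofReal_one]
  have hκm : ∀ m : ℤ, ∑' l : ℤ, ENNReal.ofReal (1 + |((l - m : ℤ) : ℝ)|)⁻¹ ^ 2 = κ := fun m =>
    (Equiv.subRight m).tsum_eq fun j : ℤ => ENNReal.ofReal (1 + |(j : ℝ)|)⁻¹ ^ 2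
  have hκl : ∀ l : ℤ, ∑' m : ℤ, ENNReal.ofReal (1 + |((l - m : ℤ) : ℝ)|)⁻¹ ^ 2 = κ := fun l =>
    (Equiv.subLeft l).tsum_eq fun j : ℤ => ENNReal.ofReal (1 + |(j : ℝ)|)⁻¹ ^ 2
  have hCS : ∀ m n : ℤ, ‖∫ ξ, unitExp (-(n * ξ)) * U m ξ‖ₑ ^ 2
      ≤ κ * ∑' l, (v (l - m)) ^ 2 * ‖cl m n l‖ₑ ^ 2 := by
    intro m n
    rw [← (hsum m n).tsum_eq]
    refine (pow_le_pow_left' enorm_tsum_le_tsum_enorm 2).trans ?_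
    have h1 := ENNReal.sq_tsum_mul_le
      (fun l : ℤ => ENNReal.ofReal (1 + |((l - m : ℤ) : ℝ)|)⁻¹) fun l => v (l - m) * ‖cl m n l‖ₑ
    simp only [← mul_assoc, hvinv, one_mul, hκm m, mul_pow] at h1
    exact h1
  have hrow : ∀ m l : ℤ, ENNReal.ofReal ((1 + |(m : ℝ)|) ^ t) * (v (l - m) ^ 2 *
      ∑' n, ‖cl m n l‖ₑ ^ 2)
      ≤ ENNReal.ofReal (1 + |((l - m : ℤ) : ℝ)|)⁻¹ ^ 2 * ENNReal.ofReal (K * Γ l) := by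
    intro m l
    have h1 : ∑' n, ‖cl m n l‖ₑ ^ 2 = ENNReal.ofReal (∫ ξ in (l : ℝ)..l + 1, ‖U m ξ‖ ^ 2) := by
      rw [← (hpar m l).tsum_eq, ENNReal.ofReal_tsum_of_nonneg (fun n => by positivity)
        (hpar m l).summable]
      refine tsum_congr fun n => ?_
      rw [ENNReal.ofReal_pow (norm_nonneg _), ofReal_norm]
    rw [h1]
    simp only [hv]
    rw [← ENNReal.ofReal_pow (by positivity), ← ENNReal.ofReal_pow (by positivity),
      ← ENNReal.ofReal_mul (by positivity), ← ENNReal.ofReal_mul (by positivity),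
      ← ENNReal.ofReal_mul (by positivity)]
    refine ENNReal.ofReal_le_ofReal ?_
    have := hw m l
    linarith
  -- In `[0, ∞]` the sums over `m`, `n` and `l` may be exchanged freely.
  have hfin : ∑' p : ℤ × ℤ, ENNReal.ofReal ((1 + |(p.1 : ℝ)|) ^ t) *
      ‖∫ ξ, unitExp (-(p.2 * ξ)) * U p.1 ξ‖ₑ ^ 2 ≠ ⊤ := by
    have hKΓ : ∑' l, ENNReal.ofReal (K * Γ l) ≠ ⊤ := (hΓs.mul_left K).tsum_ofReal_ne_top
    refine ne_top_of_le_ne_top (ENNReal.mul_ne_top hκt (ENNReal.mul_ne_top hκt hKΓ)) ?_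
    calc ∑' p : ℤ × ℤ, ENNReal.ofReal ((1 + |(p.1 : ℝ)|) ^ t) *
          ‖∫ ξ, unitExp (-(p.2 * ξ)) * U p.1 ξ‖ₑ ^ 2
        = ∑' (m : ℤ) (n : ℤ), ENNReal.ofReal ((1 + |(m : ℝ)|) ^ t) *
          ‖∫ ξ, unitExp (-(n * ξ)) * U m ξ‖ₑ ^ 2 := ENNReal.tsum_prod'
      _ ≤ ∑' (m : ℤ) (n : ℤ), ENNReal.ofReal ((1 + |(m : ℝ)|) ^ t) *
          (κ * ∑' l, (v (l - m)) ^ 2 * ‖cl m n l‖ₑ ^ 2) := by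
          gcongr with m n
          exact hCS m n
      _ = κ * ∑' (m : ℤ) (l : ℤ), ENNReal.ofReal ((1 + |(m : ℝ)|) ^ t) *
          ((v (l - m)) ^ 2 * ∑' n, ‖cl m n l‖ₑ ^ 2) := by
          rw [← ENNReal.tsum_mul_left]
          refine tsum_congr fun m => ?_
          rw [ENNReal.tsum_mul_left, ENNReal.tsum_mul_left, ENNReal.tsum_comm,
            ENNReal.tsum_mul_left, mul_left_comm]
          simp only [ENNReal.tsum_mul_left]
      _ ≤ κ * ∑' (m : ℤ) (l : ℤ), ENNReal.ofReal (1 + |((l - m : ℤ) : ℝ)|)⁻¹ ^ 2 *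
          ENNReal.ofReal (K * Γ l) := by
          refine mul_le_mul_right (ENNReal.tsum_le_tsum fun m => ENNReal.tsum_le_tsum fun l => ?_) κ
          exact hrow m l
      _ = κ * (κ * ∑' l, ENNReal.ofReal (K * Γ l)) := by
          rw [ENNReal.tsum_comm]
          simp only [ENNReal.tsum_mul_right, hκl, ENNReal.tsum_mul_left]
  refine (ENNReal.summable_toReal hfin).congr fun p => ?_
  rw [ENNReal.toReal_mul, ENNReal.toReal_ofReal (by positivity), ENNReal.toReal_pow,
    toReal_enorm, mul_comm]

/-! ### Coefficients of the windowed translates -/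

/-- A smooth window, equal to `1` near `x₀` and supported in a short interval around `x₀`. -/
def window (x₀ x : ℝ) : ℂ := stdBump ((x - x₀) / (1 / 4))

theorem stdBump_eq_one {x : ℝ} (hx : |x| ≤ 1 / 2) : stdBump x = 1 := by
  rw [stdBump, ContDiffBump.one_of_mem_closedBall _ (by simpa using hx)]
  simp

theorem conj_stdBump (x : ℝ) : conj (stdBump x) = stdBump x := Complex.conj_ofReal _

theorem contDiff_window (x₀ : ℝ) : ContDiff ℝ ∞ (window x₀) :=
  contDiff_stdBump.comp (by fun_prop : ContDiff ℝ ∞ fun x : ℝ => (x - x₀) / (1 / 4))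

theorem norm_window_le (x₀ x : ℝ) : ‖window x₀ x‖ ≤ 1 := norm_stdBump_le _

theorem window_eq_one {x₀ x : ℝ} (hx : |x - x₀| ≤ 1 / 8) : window x₀ x = 1 := by
  apply stdBump_eq_one
  rw [abs_div, abs_of_pos (by norm_num : (0 : ℝ) < 1 / 4)]
  linarith

theorem window_eq_zero {x₀ x : ℝ} (hx : 1 / 4 ≤ |x - x₀|) : window x₀ x = 0 := by
  apply stdBump_eq_zero
  rw [abs_div, abs_of_pos (by norm_num : (0 : ℝ) < 1 / 4)]
  linarith

theorem hasCompactSupport_window (x₀ : ℝ) : HasCompactSupport (window x₀) :=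
  hasCompactSupport_scaled_stdBump (by norm_num) x₀

theorem contDiff_unitExp : ContDiff ℝ ∞ unitExp := by
  unfold unitExp
  exact (contDiff_const.mul Complex.ofRealCLM.contDiff).cexp

/-- The Fourier coefficients of the windowed translates of `G`. -/
def windowCoeff (G : ℝ → ℂ) (x₀ : ℝ) (m n : ℤ) : ℂ :=
  ∫ x in (x₀ - 1 / 2)..(x₀ - 1 / 2) + 1, unitExp (-(m * x)) * (window x₀ x * G (x - n))

theorem windowCoeff_eq_integral (G : ℝ → ℂ) (x₀ : ℝ) (m n : ℤ) :
    windowCoeff G x₀ m n = ∫ x, unitExp (-(m * x)) * (window x₀ x * G (x - n)) := by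
  refine intervalIntegral.integral_eq_integral_of_support_subset fun x hx => ?_
  by_contra h
  apply hx
  simp only
  rw [window_eq_zero, zero_mul, mul_zero]
  by_contra h2
  rw [not_le, abs_lt] at h2
  exact h ⟨by linarith [h2.1], by linarith [h2.2]⟩

theorem integral_conj_windowed_eq {g : Lp ℂ 2 (volume : Measure ℝ)} {G : ℝ → ℂ}
    (hgG : g =ᵐ[volume] G) (x₀ : ℝ) (m n : ℤ) {u : ℝ → ℂ}
    (hu : ∀ x, u x = unitExp (m * x) * window x₀ (x + n)) :
    ∫ x, conj (u x) * g x = windowCoeff G x₀ m n := by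
  rw [windowCoeff_eq_integral,
    ← integral_add_right_eq_self (fun x => unitExp (-(m * x)) * (window x₀ x * G (x - n))) (n : ℝ)]
  refine integral_congr_ae ?_
  filter_upwards [hgG] with x hx
  rw [hx, hu, map_mul, conj_unitExp, window, conj_stdBump, add_sub_cancel_right]
  have : unitExp (-(m * (x + n))) = unitExp (-(m * x)) := by
    rw [show -((m : ℝ) * (x + n)) = -(m * x) + ((-(m * n) : ℤ) : ℝ) by push_cast; ring,
      unitExp_add_int]
  rw [this, ← window]
  ring

theorem fourier_windowed_eq (x₀ : ℝ) (m n : ℤ) {u w : 𝓢(ℝ, ℂ)}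
    (hu : ∀ x, u x = unitExp (m * x) * window x₀ (x + n)) (hw : ∀ x, w x = window x₀ x) (ξ : ℝ) :
    (𝓕 u) ξ = unitExp (n * ξ) * (𝓕 w) (ξ - m) := by
  rw [SchwartzMap.fourier_coe, SchwartzMap.fourier_coe, Real.fourier_eq_integral_unitExp,
    Real.fourier_eq_integral_unitExp, ← integral_const_mul,
    ← integral_add_right_eq_self (fun v => unitExp (n * ξ) * (unitExp (-(v * (ξ - m))) * w v)) (n : ℝ)]
  refine integral_congr_ae (Filter.Eventually.of_forall fun v => ?_)
  simp only
  rw [hu, hw, ← mul_assoc, ← mul_assoc, ← unitExp_add, ← unitExp_add,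
    show (n : ℝ) * ξ + -((v + n) * (ξ - m)) = -(v * ξ) + m * v + ((n * m : ℤ) : ℝ) by
      push_cast; ring, unitExp_add_int]

/-- The coefficient is a pairing of `g` with a modulated translate of the window. By Plancherel,
modulation by `m` becomes a shift that localizes `f` near `m`, and translation by `n` becomes a
character; thus `|m|` is governed by the moment of `f`. -/
theorem exists_windowCoeff_eq_fourier {g f : Lp ℂ 2 (volume : Measure ℝ)} (hf : 𝓕 g = f)
    {G : ℝ → ℂ} (hgG : g =ᵐ[volume] G) (x₀ : ℝ) :
    ∃ Ψ : ℝ → ℂ, Continuous Ψ ∧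
      (∀ k : ℕ, ∃ C : ℝ, 0 < C ∧ ∀ x, ‖Ψ x‖ ≤ C / (1 + |x|) ^ k) ∧
      ∀ m n : ℤ, windowCoeff G x₀ m n = ∫ ξ, unitExp (-(n * ξ)) * (Ψ (ξ - m) * f ξ) := by
  obtain ⟨w, hw⟩ := exists_schwartzMap_eq (contDiff_window x₀) (hasCompactSupport_window x₀)
  obtain ⟨v, hv⟩ : ∃ v : 𝓢(ℝ, ℂ), v = 𝓕 w := ⟨_, rfl⟩
  refine ⟨fun ξ => conj (v ξ), Complex.continuous_conj.comp v.continuous, fun k => ?_,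
    fun m n => ?_⟩
  · obtain ⟨C, hC, h⟩ := v.exists_norm_le_div_one_add_abs_pow k
    exact ⟨C, hC, fun x => by simpa using h x⟩
  · obtain ⟨u, hu⟩ := exists_schwartzMap_eq (f := fun x => unitExp (m * x) * window x₀ (x + n))
      ((contDiff_unitExp.comp (by fun_prop : ContDiff ℝ ∞ fun x : ℝ => (m : ℝ) * x)).mul
        ((contDiff_window x₀).comp (by fun_prop : ContDiff ℝ ∞ fun x : ℝ => x + (n : ℝ))))
      (((hasCompactSupport_window x₀).comp_homeomorph (Homeomorph.addRight (n : ℝ))).mul_left)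
    rw [← integral_conj_windowed_eq hgG x₀ m n hu, integral_conj_mul_eq_fourier, hf]
    refine integral_congr_ae (Filter.Eventually.of_forall fun ξ => ?_)
    simp only
    rw [fourier_windowed_eq x₀ m n hu hw, ← hv, map_mul, conj_unitExp, mul_assoc]

/-- Parseval in `m` over one unit interval, for each `n`. On that interval `x` is bounded, so `1 +
|n|` is comparable with `1 + |x - n|` and the sum over `n` reassembles the moment of `G`. -/
theorem summable_sq_norm_windowCoeff_mul_weight {r : ℝ} (hr : 0 ≤ r) {G : ℝ → ℂ}
    (hGc : Continuous G) (hG : Integrable fun x => (1 + |x|) ^ r * ‖G x‖ ^ 2) (x₀ : ℝ) :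
    Summable fun p : ℤ × ℤ => ‖windowCoeff G x₀ p.1 p.2‖ ^ 2 * (1 + |(p.2 : ℝ)|) ^ r := by
  set a := x₀ - 1 / 2 with ha
  set Φ : ℝ → ℝ := fun x => (1 + |x|) ^ r * ‖G x‖ ^ 2 with hΦ
  have hΦc : Continuous Φ := by
    refine Continuous.mul ?_ (hGc.norm.pow 2)
    exact Continuous.rpow_const (by fun_prop) fun x => Or.inr hr
  have hwc : Continuous (window x₀) := (contDiff_window x₀).continuous
  have hcont : ∀ n : ℤ, Continuous fun x => window x₀ x * G (x - n) := fun n =>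
    hwc.mul (hGc.comp (by fun_prop))
  have hpar : ∀ n : ℤ, HasSum (fun m => ‖windowCoeff G x₀ m n‖ ^ 2)
      (∫ x in a..a + 1, ‖window x₀ x * G (x - n)‖ ^ 2) := by
    intro n
    refine hasSum_sq_norm_integral_unitExp a ?_
    rw [memLp_two_iff_integrable_sq_norm (hcont n).aestronglyMeasurable]
    exact ((hcont n).norm.pow 2).integrableOn_Ioc
  set K : ℝ := (2 + |x₀|) ^ r with hK
  have hrow : ∀ n : ℤ, (∫ x in a..a + 1, ‖window x₀ x * G (x - n)‖ ^ 2) * (1 + |(n : ℝ)|) ^ r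
      ≤ K * ∫ x in a + ((-n : ℤ) : ℝ)..a + ((-n : ℤ) : ℝ) + 1, Φ x := by
    intro n
    have h1 : ∫ x in a + ((-n : ℤ) : ℝ)..a + ((-n : ℤ) : ℝ) + 1, Φ x
        = ∫ x in a..a + 1, Φ (x - n) := by
      rw [intervalIntegral.integral_comp_sub_right]
      congr 1 <;> push_cast <;> ring
    rw [h1, ← intervalIntegral.integral_mul_const, ← intervalIntegral.integral_const_mul]
    refine intervalIntegral.integral_mono_on (by linarith) ?_ ?_ fun x hx => ?_
    · exact (((hcont n).norm.pow 2).mul continuous_const).intervalIntegrable _ _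
    · exact (continuous_const.mul (hΦc.comp (by fun_prop))).intervalIntegrable _ _
    · have h2 : 1 + |(n : ℝ)| ≤ (2 + |x₀|) * (1 + |x - n|) := by
        have h3 := one_add_abs_le_mul (n : ℝ) x
        rw [abs_sub_comm (n : ℝ) x] at h3
        have h4 : |x| ≤ |x₀| + 1 := by
          have := abs_add_le x₀ (x - x₀)
          rw [add_sub_cancel] at this
          have h5 : |x - x₀| ≤ 1 := abs_le.2 ⟨by linarith [hx.1], by linarith [hx.2]⟩
          linarith
        have h6 : (1 + |x|) * (1 + |x - n|) ≤ (2 + |x₀|) * (1 + |x - n|) :=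
          mul_le_mul_of_nonneg_right (by linarith) (by positivity)
        linarith
      have h3 : (1 + |(n : ℝ)|) ^ r ≤ K * (1 + |x - n|) ^ r := by
        rw [hK, ← Real.mul_rpow (by positivity) (by positivity)]
        exact Real.rpow_le_rpow (by positivity) h2 hr
      have h4 : ‖window x₀ x * G (x - n)‖ ^ 2 ≤ ‖G (x - n)‖ ^ 2 := by
        rw [norm_mul]
        have := mul_le_of_le_one_left (norm_nonneg (G (x - n))) (norm_window_le x₀ x)
        gcongr
      calc ‖window x₀ x * G (x - n)‖ ^ 2 * (1 + |(n : ℝ)|) ^ r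
          ≤ ‖G (x - n)‖ ^ 2 * (K * (1 + |x - n|) ^ r) := by gcongr
        _ = K * Φ (x - n) := by simp only [hΦ]; ring
  have hΦs : Summable fun n : ℤ => K * ∫ x in a + ((-n : ℤ) : ℝ)..a + ((-n : ℤ) : ℝ) + 1, Φ x := by
    have h1 := (hG.hasSum_intervalIntegral a).summable
    exact (h1.comp_injective (neg_injective (G := ℤ))).mul_left K
  have hs : Summable fun p : ℤ × ℤ => ‖windowCoeff G x₀ p.2 p.1‖ ^ 2 * (1 + |(p.1 : ℝ)|) ^ r := by
    rw [summable_prod_of_nonneg fun p => by positivity]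
    have hrs : ∀ n : ℤ, Summable fun m : ℤ =>
        ‖windowCoeff G x₀ m n‖ ^ 2 * (1 + |(n : ℝ)|) ^ r := fun n =>
      (hpar n).summable.mul_right ((1 + |(n : ℝ)|) ^ r)
    refine ⟨hrs, ?_⟩
    have hval : ∀ n : ℤ, ∑' m : ℤ, ‖windowCoeff G x₀ m n‖ ^ 2 * (1 + |(n : ℝ)|) ^ r
        = (∫ x in a..a + 1, ‖window x₀ x * G (x - n)‖ ^ 2) * (1 + |(n : ℝ)|) ^ r := fun n => by
      rw [tsum_mul_right, (hpar n).tsum_eq]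
    simp only [hval]
    refine Summable.of_nonneg_of_le (fun n => ?_) hrow hΦs
    rw [← hval]
    exact tsum_nonneg fun m => by positivity
  exact (Equiv.prodComm ℤ ℤ).summable_iff.2 hs

/-- Localization of `g` and of its Fourier transform, in terms of the coefficients of its windowed
translates. -/
theorem exists_continuous_windowCoeff_summable {r t : ℝ} (hr : 0 ≤ r) (ht : 1 < t)
    {g f : Lp ℂ 2 (volume : Measure ℝ)} (hf : 𝓕 g = f) (hgr : momentL2 r g ≠ ⊤)
    (hft : momentL2 t f ≠ ⊤) :
    ∃ G : ℝ → ℂ, Continuous G ∧ g =ᵐ[volume] G ∧ ∀ x₀ : ℝ, Summable fun p : ℤ × ℤ =>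
      ‖windowCoeff G x₀ p.1 p.2‖ ^ 2 * (1 + |(p.1 : ℝ)| ^ t + |(p.2 : ℝ)| ^ r) := by
  have ht0 : 0 ≤ t := by linarith
  have h1 := integrable_weight_of_momentL2 hr hgr
  have h2 := integrable_weight_of_momentL2 ht0 hft
  have h3 := integrable_of_integrable_weight ht h2
  obtain ⟨G, hGc, hgG⟩ := exists_continuous_ae_eq hf h3
  refine ⟨G, hGc, hgG, fun x₀ => ?_⟩
  obtain ⟨Ψ, hΨc, hΨ, hco⟩ := exists_windowCoeff_eq_fourier hf hgG x₀
  have h4 := summable_sq_norm_integral_mul_weight ht0 h3 h2 hΨc hΨ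
  simp only [← hco] at h4
  have h5 := summable_sq_norm_windowCoeff_mul_weight hr hGc
    (h1.congr (by filter_upwards [hgG] with x hx; rw [hx])) x₀
  refine Summable.of_nonneg_of_le (fun p => by positivity) (fun p => ?_)
    (h4.add (h5.mul_left 2))
  have h6 : |(p.1 : ℝ)| ^ t ≤ (1 + |(p.1 : ℝ)|) ^ t :=
    Real.rpow_le_rpow (abs_nonneg _) (by linarith) ht0
  have h7 : |(p.2 : ℝ)| ^ r ≤ (1 + |(p.2 : ℝ)|) ^ r :=
    Real.rpow_le_rpow (abs_nonneg _) (by linarith) hr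
  have h8 : 1 ≤ (1 + |(p.2 : ℝ)|) ^ r :=
    Real.one_le_rpow (by linarith [abs_nonneg (p.2 : ℝ)]) hr
  nlinarith [sq_nonneg ‖windowCoeff G x₀ p.1 p.2‖]

/-! ### Expansion of the Zak transform and its size near a zero -/

section Expansion

variable {G : ℝ → ℂ} {x₀ x : ℝ}

theorem hasSum_windowCoeff (hGc : Continuous G)
    (hs : Summable fun p : ℤ × ℤ => ‖windowCoeff G x₀ p.1 p.2‖) (hx : |x - x₀| ≤ 1 / 8) (n : ℤ) :
    HasSum (fun m => windowCoeff G x₀ m n * unitExp (m * x)) (G (x - n)) := by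
  have hs' : Summable fun m => windowCoeff G x₀ m n :=
    (hs.comp_injective (i := fun m : ℤ => (m, n)) fun a b h => (Prod.ext_iff.1 h).1).of_norm
  have h := abs_le.1 hx
  have := hasSum_unitExp_of_summable (x₀ - 1 / 2) (f := fun x => window x₀ x * G (x - n))
    ((contDiff_window x₀).continuous.mul (hGc.comp (by fun_prop)))
    (by rw [window_eq_zero (by norm_num), zero_mul])
    (by
      rw [window_eq_zero, zero_mul]
      rw [show x₀ - 1 / 2 + 1 - x₀ = 1 / 2 by ring]; norm_num)
    hs' (x := x) ⟨by linarith [h.1], by linarith [h.2]⟩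
  simp only [window_eq_one hx, one_mul] at this
  exact this

theorem hasSum_zakSum (hGc : Continuous G)
    (hs : Summable fun p : ℤ × ℤ => ‖windowCoeff G x₀ p.1 p.2‖) (hx : |x - x₀| ≤ 1 / 8) (y : ℝ) :
    (Summable fun n : ℤ => G (x - n)) ∧
      HasSum (fun p : ℤ × ℤ => windowCoeff G x₀ p.1 p.2 * unitExp (p.1 * x + p.2 * y))
        (zakSum G x y) := by
  have hs1 : Summable fun p : ℤ × ℤ => windowCoeff G x₀ p.2 p.1 * unitExp (p.2 * x + p.1 * y) :=
    summable_mul_unitExp (((Equiv.prodComm ℤ ℤ).summable_iff.2 hs).of_norm) _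
  have hs0 : Summable fun p : ℤ × ℤ => windowCoeff G x₀ p.2 p.1 * unitExp (p.2 * x) :=
    summable_mul_unitExp (((Equiv.prodComm ℤ ℤ).summable_iff.2 hs).of_norm) _
  have hrow : ∀ n : ℤ, HasSum (fun m : ℤ => windowCoeff G x₀ m n * unitExp (m * x + n * y))
      (G (x - n) * unitExp (n * y)) := fun n => by
    simpa only [unitExp_add, mul_assoc] using
      (hasSum_windowCoeff hGc hs hx n).mul_right (unitExp (n * y))
  refine ⟨?_, ?_⟩
  · refine hs0.prod.congr fun n => ?_
    exact (hasSum_windowCoeff hGc hs hx n).tsum_eq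
  · have h1 := hs1.hasSum
    rw [hs1.tsum_prod] at h1
    simp only [(hrow _).tsum_eq] at h1
    exact (Equiv.prodComm ℤ ℤ).hasSum_iff.1 h1

end Expansion

/-- On the strip `|x - x₀| < 1/8`, where the window is `1`, the Zak transform agrees with a
uniformly convergent double series built from the window at `x₀`. -/
theorem continuous_zakSum {G : ℝ → ℂ} (hGc : Continuous G)
    (hs : ∀ x₀, Summable fun p : ℤ × ℤ => ‖windowCoeff G x₀ p.1 p.2‖) :
    Continuous (Function.uncurry (zakSum G)) := by
  rw [continuous_iff_continuousAt]
  rintro ⟨x₀, y₀⟩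
  have h1 : Continuous fun z : ℝ × ℝ =>
      ∑' p : ℤ × ℤ, windowCoeff G x₀ p.1 p.2 * unitExp (p.1 * z.1 + p.2 * z.2) :=
    continuous_tsum (fun p => continuous_const.mul (continuous_unitExp.comp (by fun_prop))) (hs x₀)
      fun p z => by simp
  refine h1.continuousAt.congr ?_
  have h2 : ∀ᶠ z : ℝ × ℝ in nhds (x₀, y₀), |z.1 - x₀| < 1 / 8 := by
    have h3 : Continuous fun z : ℝ × ℝ => |z.1 - x₀| := by fun_prop
    exact h3.continuousAt.eventually_lt continuousAt_const (by simp)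
  filter_upwards [h2] with z hz
  exact (hasSum_zakSum hGc (hs x₀) hz.le z.2).2.tsum_eq

/-- Near a zero, the Zak transform is controlled by the coefficients of the windowed translates. -/
theorem norm_zakSum_le_of_zero {G : ℝ → ℂ} (hGc : Continuous G) {x₀ y₀ : ℝ}
    (hs : Summable fun p : ℤ × ℤ => ‖windowCoeff G x₀ p.1 p.2‖) (h0 : zakSum G x₀ y₀ = 0)
    {a b x y : ℝ} (ha : a ≤ 1 / 8) (hx : |x - x₀| ≤ a) (hy : |y - y₀| ≤ b) :
    ‖zakSum G x y‖ ≤ 2 * Real.pi *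
      (∑' p : ℤ × ℤ, ‖windowCoeff G x₀ p.1 p.2‖ * min 1 (|(p.1 : ℝ)| * a)
        + ∑' p : ℤ × ℤ, ‖windowCoeff G x₀ p.1 p.2‖ * min 1 (|(p.2 : ℝ)| * b)) := by
  have ha0 : 0 ≤ a := (abs_nonneg _).trans hx
  have hb0 : 0 ≤ b := (abs_nonneg _).trans hy
  set c : ℤ × ℤ → ℂ := fun p => windowCoeff G x₀ p.1 p.2 with hc
  have hsub : ∀ φ : ℤ × ℤ → ℝ, (∀ p, 0 ≤ φ p) →
      Summable fun p : ℤ × ℤ => ‖c p‖ * min 1 (φ p) := fun φ hφ =>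
    Summable.of_nonneg_of_le (fun p => mul_nonneg (norm_nonneg _) (le_min zero_le_one (hφ p)))
      (fun p => mul_le_of_le_one_right (norm_nonneg _) (min_le_left _ _)) hs
  have hs1 := hsub (fun p => |(p.1 : ℝ)| * a) fun p => by positivity
  have hs2 := hsub (fun p => |(p.2 : ℝ)| * b) fun p => by positivity
  have h1 := ((hasSum_zakSum hGc hs (hx.trans ha) y).2).sub
    (hasSum_zakSum hGc hs (x := x₀) (by simp) y₀).2
  rw [h0, sub_zero] at h1
  -- The two variables are changed one at a time, so that each increment keeps its own scale.
  have hstep : ∀ s s₀ t t₀ : ℝ, ‖unitExp (s + t) - unitExp (s₀ + t₀)‖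
      ≤ 2 * Real.pi * (min 1 |s - s₀| + min 1 |t - t₀|) := by
    intro s s₀ t t₀
    have e1 : unitExp (s + t) - unitExp (s₀ + t₀)
        = unitExp (s₀ + t) * (unitExp (s - s₀) - 1) + unitExp (s₀ + t₀) * (unitExp (t - t₀) - 1) := by
      rw [mul_sub, mul_sub, ← unitExp_add, ← unitExp_add]
      rw [show s₀ + t + (s - s₀) = s + t by ring, show s₀ + t₀ + (t - t₀) = s₀ + t by ring]
      ring
    rw [e1, mul_add]
    refine (norm_add_le _ _).trans (add_le_add ?_ ?_)
    · rw [norm_mul, norm_unitExp, one_mul]; exact norm_unitExp_sub_one_le_min _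
    · rw [norm_mul, norm_unitExp, one_mul]; exact norm_unitExp_sub_one_le_min _
  have hle : ∀ p : ℤ × ℤ,
      ‖c p * unitExp (p.1 * x + p.2 * y) - c p * unitExp (p.1 * x₀ + p.2 * y₀)‖
      ≤ 2 * Real.pi * (‖c p‖ * min 1 (|(p.1 : ℝ)| * a) + ‖c p‖ * min 1 (|(p.2 : ℝ)| * b)) := by
    intro p
    rw [← mul_sub, norm_mul, ← mul_add, mul_left_comm]
    refine mul_le_mul_of_nonneg_left ((hstep _ _ _ _).trans ?_) (norm_nonneg _)
    rw [← mul_sub, ← mul_sub, abs_mul, abs_mul]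
    have := Real.pi_pos
    gcongr
  rw [← hs1.tsum_add hs2, ← tsum_mul_left, ← h1.tsum_eq]
  exact tsum_of_norm_bounded ((hs1.add hs2).mul_left _).hasSum hle

/-! ### Testing on a small rectangle: the critical case -/

theorem integral_le_of_le_of_le {φ : ℝ → ℝ} (hφ : Continuous φ) {x₀ a P Q : ℝ} (ha : 0 ≤ a)
    (ha2 : a ≤ 1 / 2) (hQ0 : 0 ≤ Q) (hP : ∀ x, |x - x₀| ≤ a → φ x ≤ P)
    (hQ : ∀ x, |x - x₀| ≤ 1 / 2 → a ≤ |x - x₀| → φ x ≤ Q) :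
    ∫ x in (x₀ - 1 / 2)..(x₀ - 1 / 2) + 1, φ x ≤ 2 * a * P + Q := by
  have hi : ∀ u v : ℝ, IntervalIntegrable φ volume u v := fun u v => hφ.intervalIntegrable u v
  have hconst : ∀ u v K : ℝ, u ≤ v → (∀ x ∈ Set.Icc u v, φ x ≤ K) →
      ∫ x in u..v, φ x ≤ (v - u) * K := by
    intro u v K huv h
    have := intervalIntegral.integral_mono_on huv (hi u v)
      (intervalIntegrable_const (μ := volume) (c := K)) h
    simpa using this
  rw [← intervalIntegral.integral_add_adjacent_intervals (hi _ (x₀ - a)) (hi _ _),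
    ← intervalIntegral.integral_add_adjacent_intervals (hi (x₀ - a) (x₀ + a)) (hi _ _)]
  have h1 := hconst (x₀ - 1 / 2) (x₀ - a) Q (by linarith) fun x hx => by
    have : |x - x₀| = x₀ - x := by rw [abs_sub_comm]; exact abs_of_nonneg (by linarith [hx.2])
    exact hQ x (by rw [this]; linarith [hx.1]) (by rw [this]; linarith [hx.2])
  have h2 := hconst (x₀ - a) (x₀ + a) P (by linarith) fun x hx =>
    hP x (abs_le.2 ⟨by linarith [hx.1], by linarith [hx.2]⟩)
  have h3 := hconst (x₀ + a) (x₀ - 1 / 2 + 1) Q (by linarith) fun x hx => by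
    have : |x - x₀| = x - x₀ := abs_of_nonneg (by linarith [hx.1])
    exact hQ x (by rw [this]; linarith [hx.2]) (by rw [this]; linarith [hx.1])
  nlinarith [mul_nonneg ha hQ0]

/-- The localized weighted `L²` norm of a function that is small on a rectangle. -/
theorem integral_trigSum_sq_le {F : ℝ → ℝ → ℂ} (hF : Continuous (Function.uncurry F))
    (hper : ∀ x y, F x (y + 1) = F x y) {x₀ y₀ a b σ η M : ℝ} (ha : 0 ≤ a) (ha2 : a ≤ 1 / 2)
    (hb : 0 ≤ b) (hb2 : b ≤ 1 / 2) (hη1 : η ≤ 1)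
    (hσ : ∀ x y, |x - x₀| ≤ a → |y - y₀| ≤ b → ‖F x y‖ ≤ σ)
    (hM : ∀ x y, |x - x₀| ≤ 1 / 2 → |y - y₀| ≤ 1 / 2 → ‖F x y‖ ≤ M)
    {s s' : Finset ℤ} {A B : ℤ → ℂ}
    (hA : ∀ x, |x - x₀| ≤ 1 / 2 → ‖trigSum s A x‖ ≤ 1 + η)
    (hA' : ∀ x, |x - x₀| ≤ 1 / 2 → a ≤ |x - x₀| → ‖trigSum s A x‖ ≤ η)
    (hB : ∀ y, |y - -y₀| ≤ 1 / 2 → ‖trigSum s' B y‖ ≤ 1 + η)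
    (hB' : ∀ y, |y - -y₀| ≤ 1 / 2 → b ≤ |y - -y₀| → ‖trigSum s' B y‖ ≤ η) :
    ∫ x in (x₀ - 1 / 2)..(x₀ - 1 / 2) + 1, ‖trigSum s A x‖ ^ 2 *
      ∫ y in (0 : ℝ)..0 + 1, ‖trigSum s' B (-y) * F x y‖ ^ 2
      ≤ 64 * (a * b * σ ^ 2) + 12 * (η * M) ^ 2 := by
  have hBc : Continuous fun y : ℝ => trigSum s' B (-y) :=
    (continuous_trigSum s' B).comp (by fun_prop)
  set J : ℝ → ℝ := fun x => ∫ y in (0 : ℝ)..0 + 1, ‖trigSum s' B (-y) * F x y‖ ^ 2 with hJ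
  have hJc : Continuous J := by
    apply intervalIntegral.continuous_parametric_intervalIntegral_of_continuous'
    exact ((hBc.comp continuous_snd).mul hF).norm.pow 2
  have hJ0 : ∀ x, 0 ≤ J x := fun x =>
    intervalIntegral.integral_nonneg (by norm_num) fun y _ => by positivity
  have hneg : ∀ y : ℝ, |-y - -y₀| = |y - y₀| := fun y => by
    rw [show -y - -y₀ = -(y - y₀) by ring, abs_neg]
  have hJshift : ∀ x, J x
      = ∫ y in (y₀ - 1 / 2)..(y₀ - 1 / 2) + 1, ‖trigSum s' B (-y) * F x y‖ ^ 2 := by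
    intro x
    have hp : Function.Periodic (fun y => ‖trigSum s' B (-y) * F x y‖ ^ 2) 1 := by
      intro y
      simp only
      rw [hper, ← trigSum_add_int s' B (-(y + 1)) 1]
      congr 4
      push_cast; ring
    exact hp.intervalIntegral_add_eq 0 (y₀ - 1 / 2)
  have hFx : ∀ x, Continuous (F x) := fun x => hF.comp (f := fun y => (x, y)) (by fun_prop)
  have hcont : ∀ x, Continuous fun y => ‖trigSum s' B (-y) * F x y‖ ^ 2 := fun x =>
    (hBc.mul (hFx x)).norm.pow 2
  have hsq : ∀ {z w : ℂ} {u v : ℝ}, ‖z‖ ≤ u → ‖w‖ ≤ v → ‖z * w‖ ^ 2 ≤ (u * v) ^ 2 := by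
    intro z w u v h1 h2
    rw [norm_mul]
    have := (norm_nonneg z).trans h1
    gcongr
  have hJin : ∀ x, |x - x₀| ≤ a → J x ≤ 2 * b * (2 * σ) ^ 2 + (η * M) ^ 2 := by
    intro x hx
    rw [hJshift]
    refine integral_le_of_le_of_le (hcont x) hb hb2 (by positivity) (fun y hy => ?_)
      fun y hy hy' => ?_
    · refine hsq ?_ (hσ x y hx hy)
      linarith [hB (-y) (by rw [hneg]; linarith)]
    · exact hsq (hB' (-y) (by rw [hneg]; exact hy) (by rw [hneg]; exact hy'))
        (hM x y (by linarith) hy)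
  have hJout : ∀ x, |x - x₀| ≤ 1 / 2 → J x ≤ (2 * M) ^ 2 := by
    intro x hx
    rw [hJshift]
    have h1 : ∀ y, |y - y₀| ≤ 1 / 2 → ‖trigSum s' B (-y) * F x y‖ ^ 2 ≤ (2 * M) ^ 2 := by
      intro y hy
      refine hsq ?_ (hM x y hx hy)
      linarith [hB (-y) (by rw [hneg]; exact hy)]
    have := integral_le_of_le_of_le (hcont x) (x₀ := y₀) (P := (2 * M) ^ 2) le_rfl (by norm_num)
      (sq_nonneg (2 * M)) (fun y hy => h1 y (by linarith)) fun y hy _ => h1 y hy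
    simpa using this
  have hmul : ∀ {z : ℂ} {u j v : ℝ}, ‖z‖ ≤ u → 0 ≤ j → j ≤ v → ‖z‖ ^ 2 * j ≤ u ^ 2 * v := by
    intro z u j v h1 h2 h3
    have := (norm_nonneg z).trans h1
    gcongr
  have hmain := integral_le_of_le_of_le (φ := fun x => ‖trigSum s A x‖ ^ 2 * J x)
    (((continuous_trigSum s A).norm.pow 2).mul hJc) (x₀ := x₀) ha ha2
    (P := 2 ^ 2 * (2 * b * (2 * σ) ^ 2 + (η * M) ^ 2)) (Q := η ^ 2 * (2 * M) ^ 2) (by positivity)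
    (fun x hx => hmul (by linarith [hA x (by linarith)]) (hJ0 x) (hJin x hx))
    (fun x hx hx' => hmul (hA' x hx hx') (hJ0 x) (hJout x hx))
  refine hmain.trans ?_
  -- With `1 + η ≤ 2` the bound reads `64abσ² + 8a(ηM)² + 4(ηM)²`, and `a ≤ 1/2`.
  nlinarith [mul_nonneg (sub_nonneg.2 ha2) (sq_nonneg (η * M))]

theorem tendsto_rpow_nhdsGT_zero {e : ℝ} (he : 0 < e) :
    Filter.Tendsto (fun ε : ℝ => ε ^ e) (nhdsWithin 0 (Set.Ioi 0)) (nhds 0) := by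
  have h : Filter.Tendsto (fun ε : ℝ => ε ^ e) (nhds 0) (nhds (0 ^ e)) :=
    (Real.continuousAt_rpow_const 0 e (Or.inr he.le)).tendsto
  rw [Real.zero_rpow he.ne'] at h
  exact h.mono_left nhdsWithin_le_nhds

theorem one_lt_mul_one_sub {r t : ℝ} (ht : 0 < t) (h : 1 / r + 1 / t < 1) :
    1 < t * (1 - 1 / r) := by
  have h1 : 1 / t < 1 - 1 / r := by linarith
  rw [div_lt_iff₀ ht] at h1
  linarith

/-- The Balian–Low type theorem at the critical exponents. -/
theorem not_isExactCqSystem_of_moments {q r t : ℝ} (hq : 2 < q) (hr : 1 < r) (ht : 1 < t)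
    (hsum : 1 / r + 1 / t = q / (q - 1) / 2) (h3 : t * (1 - 1 / r) < 3)
    (h3' : r * (1 - 1 / t) < 3) {g f : Lp ℂ 2 (volume : Measure ℝ)} (hf : 𝓕 g = f)
    (hgr : momentL2 r g ≠ ⊤) (hft : momentL2 t f ≠ ⊤) :
    ¬ IsExactCqSystem q (gaborSystem g) := by
  intro hg
  have hr0 : 0 < r := by linarith
  have ht0 : 0 < t := by linarith
  have hq0 : 0 < q := by linarith
  have hq1 : 0 < q - 1 := by linarith
  have hlt : 1 / r + 1 / t < 1 := by
    rw [hsum, div_div, div_lt_one (by positivity)]; linarith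
  have h1 := one_lt_mul_one_sub ht0 hlt
  have h1' := one_lt_mul_one_sub (r := t) hr0 (by linarith)
  obtain ⟨G, hGc, hgG, hcoef⟩ := exists_continuous_windowCoeff_summable hr0.le ht hf hgr hft
  have hcs := fun x₀ => summable_norm_of_weight hr h1 (hcoef x₀)
  have hG : ∀ x, Summable fun n : ℤ => G (x - n) := fun x =>
    (hasSum_zakSum hGc (hcs x) (by simp) 0).1
  have hF := continuous_zakSum hGc hcs
  obtain ⟨x₀, y₀, h0⟩ := exists_zero_of_quasiperiodic hF (zakSum_add_one_right G)
    (zakSum_add_one_left G)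
  obtain ⟨C, hC, hbound⟩ := hg.exists_trigSum_bound hq0 hgG hGc hG hF
  obtain ⟨c, hc, hloc⟩ := exists_trigSum_localized hq0
  obtain ⟨M, hM⟩ : ∃ M, ∀ x y, |x - x₀| ≤ 1 / 2 → |y - y₀| ≤ 1 / 2 → ‖zakSum G x y‖ ≤ M := by
    have hK : IsCompact (Metric.closedBall x₀ (1 / 2) ×ˢ Metric.closedBall y₀ (1 / 2)) :=
      (isCompact_closedBall x₀ (1 / 2)).prod (isCompact_closedBall y₀ (1 / 2))
    obtain ⟨M, hM⟩ := hK.exists_bound_of_continuousOn hF.continuousOn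
    exact ⟨M, fun x y hx hy => hM (x, y)
      ⟨by simpa [Real.dist_eq] using hx, by simpa [Real.dist_eq] using hy⟩⟩
  have hM0 : 0 ≤ M := (norm_nonneg _).trans (hM x₀ y₀ (by simp) (by simp))
  have hpi := Real.pi_pos
  -- Chosen so that `C * 10 * (4π) * δ = c² / 2`: the final upper bound is half of the lower bound.
  set δ : ℝ := c ^ 2 / (C * (80 * Real.pi)) with hδ
  have hδ0 : 0 < δ := by positivity
  have hev1 := tsum_norm_mul_min_isLittleO hr ht0 h1 h3 (hcoef x₀) hδ0
  have hev2 := tsum_norm_mul_min_isLittleO (c := fun p => windowCoeff G x₀ p.2 p.1) ht hr0 h1' h3'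
    (((Equiv.prodComm ℤ ℤ).summable_iff.2 (hcoef x₀)).congr fun p => by
      simp only [Function.comp, Equiv.prodComm_apply, Prod.fst_swap, Prod.snd_swap]
      ring) hδ0
  have hev3 := (tendsto_rpow_nhdsGT_zero (e := 2 / t) (by positivity)).eventually
    (gt_mem_nhds (show (0 : ℝ) < 1 / 8 by norm_num))
  have hev4 := (tendsto_rpow_nhdsGT_zero (e := 2 / r) (by positivity)).eventually
    (gt_mem_nhds (show (0 : ℝ) < 1 / 8 by norm_num))
  obtain ⟨ε, hε1, hε2, hεa, hεb, hε0⟩ :=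
    (hev1.and (hev2.and (hev3.and (hev4.and self_mem_nhdsWithin)))).exists
  -- With these side lengths both sums bounding the Zak transform have the same order `ε^θ`.
  set a := ε ^ (2 / t) with ha
  set b := ε ^ (2 / r) with hb
  have ha0 : 0 < a := by positivity
  have hb0 : 0 < b := by positivity
  set θ := 1 - 1 / r - 1 / t with hθ
  rw [show 1 - 1 / t - 1 / r = θ by rw [hθ]; ring] at hε2
  set σ := 4 * Real.pi * (δ * ε ^ θ) with hσ
  have hσ0 : 0 < σ := by positivity
  have hsmall : ∀ x y, |x - x₀| ≤ a → |y - y₀| ≤ b → ‖zakSum G x y‖ ≤ σ := by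
    intro x y hx hy
    have h := norm_zakSum_le_of_zero hGc (hcs x₀) h0 hεa.le hx hy
    have h2 : ∑' p : ℤ × ℤ, ‖windowCoeff G x₀ p.1 p.2‖ * min 1 (|(p.2 : ℝ)| * b) ≤ δ * ε ^ θ := by
      rw [← (Equiv.prodComm ℤ ℤ).tsum_eq]
      exact hε2
    refine h.trans ?_
    rw [hσ]
    nlinarith
  -- The contribution from outside the rectangle becomes no larger than the main term `abσ²`; `M +
  -- 1` avoids division by zero.
  set η := min 1 (σ * √(a * b) / (M + 1)) with hη
  have hη0 : 0 < η := lt_min one_pos (by positivity)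
  have hηM : (η * M) ^ 2 ≤ a * b * σ ^ 2 := by
    have h2 : η * M ≤ σ * √(a * b) := by
      calc η * M ≤ σ * √(a * b) / (M + 1) * (M + 1) := by
            gcongr
            · exact min_le_right _ _
            · linarith
        _ = σ * √(a * b) := by field_simp
    calc (η * M) ^ 2 ≤ (σ * √(a * b)) ^ 2 := by gcongr
      _ = a * b * σ ^ 2 := by rw [mul_pow, Real.sq_sqrt (by positivity)]; ring
  obtain ⟨s, A, hA, hA1, hA2⟩ := hloc a ha0 (by linarith) x₀ η hη0
  obtain ⟨s', B, hB, hB1, hB2⟩ := hloc b hb0 (by linarith) (-y₀) η hη0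
  have hint := integral_trigSum_sq_le hF (zakSum_add_one_right G) ha0.le (by linarith) hb0.le
    (by linarith) (min_le_left _ _) hsmall hM hA1 hA2 hB1 hB2
  have hfinal := hbound s s' A B (x₀ - 1 / 2)
  have hsqrt : √(∫ x in (x₀ - 1 / 2)..(x₀ - 1 / 2) + 1, ‖trigSum s A x‖ ^ 2 *
      ∫ y in (0 : ℝ)..0 + 1, ‖trigSum s' B (-y) * zakSum G x y‖ ^ 2) ≤ 10 * (√(a * b) * σ) := by
    -- `64 + 12 ≤ 10²`.
    refine Real.sqrt_le_iff.2 ⟨by positivity, hint.trans ?_⟩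
    have e : (10 * (√(a * b) * σ)) ^ 2 = 100 * (a * b * σ ^ 2) := by
      rw [show (10 * (√(a * b) * σ)) ^ 2 = 100 * (√(a * b) ^ 2 * σ ^ 2) by ring,
        Real.sq_sqrt (by positivity)]
    have : 0 ≤ a * b * σ ^ 2 := by positivity
    rw [e]
    linarith
  -- Criticality enters here: `ab = ε^(q')`, so `(ab)^(1/q')` and `(ab)^(1/2) ε^θ` both equal `ε`.
  have hab : a * b = ε ^ (q / (q - 1)) := by
    rw [ha, hb, ← Real.rpow_add hε0]
    congr 1
    have : 2 / t + 2 / r = 2 * (1 / r + 1 / t) := by ring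
    rw [this, hsum]; ring
  have hpow1 : a ^ (1 - 1 / q) * b ^ (1 - 1 / q) = ε := by
    rw [← Real.mul_rpow ha0.le hb0.le, hab, ← Real.rpow_mul hε0.le]
    rw [show q / (q - 1) * (1 - 1 / q) = 1 by field_simp, Real.rpow_one]
  have hpow2 : √(a * b) * ε ^ θ = ε := by
    rw [hab, Real.sqrt_eq_rpow, ← Real.rpow_mul hε0.le, ← Real.rpow_add hε0]
    rw [show q / (q - 1) * (1 / 2) + θ = 1 by rw [hθ]; linarith, Real.rpow_one]
  have hlow : c ^ 2 * ε
      ≤ (∑ m ∈ s, ‖A m‖ ^ q) ^ (1 / q) * (∑ n ∈ s', ‖B n‖ ^ q) ^ (1 / q) := by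
    calc c ^ 2 * ε = (c * a ^ (1 - 1 / q)) * (c * b ^ (1 - 1 / q)) := by
          rw [← hpow1]; ring
      _ ≤ _ := by gcongr
  have hup : C * (10 * (√(a * b) * σ)) = c ^ 2 * ε / 2 := by
    calc C * (10 * (√(a * b) * σ)) = C * (40 * Real.pi) * δ * (√(a * b) * ε ^ θ) := by
          rw [hσ]; ring
      _ = c ^ 2 * ε / 2 := by rw [hpow2, hδ]; field_simp; ring
  have hcontra : c ^ 2 * ε ≤ c ^ 2 * ε / 2 := by
    refine hlow.trans (hfinal.trans ?_)
    rw [← hup]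
    exact mul_le_mul_of_nonneg_left hsqrt hC.le
  have : 0 < c ^ 2 * ε := by positivity
  linarith

/-! ### Reduction to the critical exponents -/

theorem momentL2_ne_top_of_le {r r' : ℝ} (hr' : 0 ≤ r') (h : r' ≤ r)
    {g : Lp ℂ 2 (volume : Measure ℝ)} (hg : momentL2 r g ≠ ⊤) : momentL2 r' g ≠ ⊤ := by
  have h1 := (integrable_weight_of_momentL2 (hr'.trans h) hg).lintegral_lt_top
  refine ne_top_of_le_ne_top h1.ne (lintegral_mono fun x => ENNReal.ofReal_le_ofReal ?_)
  have h2 : |x| ^ r' ≤ (1 + |x|) ^ r' :=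
    Real.rpow_le_rpow (abs_nonneg _) (by linarith) hr'
  have h3 : (1 + |x|) ^ r' ≤ (1 + |x|) ^ r :=
    Real.rpow_le_rpow_of_exponent_le (by linarith [abs_nonneg x]) h
  exact mul_le_mul_of_nonneg_right (h2.trans h3) (sq_nonneg _)

/-- In terms of `ρ = 1/r` and `τ = 1/t`: on the line `ρ + τ = s` the condition `t(1 - 1/r) < 3`
reads `τ > (1 - s)/2`, equivalently `ρ < (3s - 1)/2`, and symmetrically. The midpoint of the line is
admissible because `s > 1/2`; otherwise the larger reciprocal is kept and the other one raised. -/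
theorem exists_critical_exponents {ρ τ s : ℝ} (hs : 1 / 2 < s)
    (hρ : ρ < (3 * s - 1) / 2) (hτ : τ < (3 * s - 1) / 2) (h : ρ + τ ≤ s) :
    ∃ ρ' τ', ρ ≤ ρ' ∧ τ ≤ τ' ∧ ρ' + τ' = s ∧ (1 - s) / 2 < ρ' ∧ (1 - s) / 2 < τ' := by
  rcases le_or_gt ρ (s / 2) with h1 | h1
  · rcases le_or_gt τ (s / 2) with h2 | h2
    · exact ⟨s / 2, s / 2, h1, h2, by ring, by linarith, by linarith⟩
    · exact ⟨s - τ, τ, by linarith, le_rfl, by ring, by linarith, by linarith⟩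
  · exact ⟨ρ, s - ρ, le_rfl, by linarith, by ring, by linarith, by linarith⟩

theorem momentL2_eq_top_or {q r t : ℝ} (hq : 2 < q) (hr : 4 * (q - 1) / (q + 2) < r)
    (ht : 4 * (q - 1) / (q + 2) < t) (hsum : 1 / r + 1 / t ≤ (q / (q - 1)) / 2)
    {g : Lp ℂ 2 (volume : Measure ℝ)} (hg : IsExactCqSystem q (gaborSystem g)) :
    momentL2 r g = ⊤ ∨ momentL2 t (𝓕 g) = ⊤ := by
  by_contra! hcon
  obtain ⟨hgr, hft⟩ := hcon
  have hq1 : 0 < q - 1 := by linarith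
  set s := (q / (q - 1)) / 2 with hs
  have hs1 : s < 1 := by
    rw [hs, div_div, div_lt_one (by positivity)]; linarith
  have hs2 : 1 / 2 < s := by
    rw [hs, div_div, div_lt_div_iff₀ (by norm_num) (by positivity)]; linarith
  have hpos : 0 < 4 * (q - 1) / (q + 2) := by positivity
  -- The threshold on `r` and `t` is the reciprocal of the largest value allowed by
  -- `exists_critical_exponents`. Raising a reciprocal lowers the exponent, which keeps the moment
  -- finite.
  have hthr : 1 / (4 * (q - 1) / (q + 2)) = (3 * s - 1) / 2 := by
    rw [hs]; field_simp; ring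
  have hr0 : 0 < r := hpos.trans hr
  have ht0 : 0 < t := hpos.trans ht
  have hρ : 1 / r < (3 * s - 1) / 2 := by rw [← hthr]; exact one_div_lt_one_div_of_lt hpos hr
  have hτ : 1 / t < (3 * s - 1) / 2 := by rw [← hthr]; exact one_div_lt_one_div_of_lt hpos ht
  obtain ⟨ρ, τ, hρ1, hτ1, hρτ, hρ2, hτ2⟩ := exists_critical_exponents hs2 hρ hτ hsum
  have hρ0 : 0 < ρ := by linarith
  have hτ0 : 0 < τ := by linarith
  have hle : ∀ {u v : ℝ}, 0 < u → 0 < v → 1 / u ≤ v → 1 / v ≤ u := fun hu hv h => by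
    rwa [div_le_comm₀ hv hu]
  refine not_isExactCqSystem_of_moments (r := 1 / ρ) (t := 1 / τ) hq ?_ ?_ ?_ ?_ ?_ rfl
    (momentL2_ne_top_of_le (by positivity) (hle hr0 hρ0 hρ1) hgr)
    (momentL2_ne_top_of_le (by positivity) (hle ht0 hτ0 hτ1) hft) hg
  · rw [lt_div_iff₀ hρ0]; linarith
  · rw [lt_div_iff₀ hτ0]; linarith
  · rw [one_div_one_div, one_div_one_div, hρτ]
  · rw [one_div_one_div, one_div_mul_eq_div, div_lt_iff₀ hτ0]; linarith
  · rw [one_div_one_div, one_div_mul_eq_div, div_lt_iff₀ hρ0]; linarith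
end

theorem mainTheorem7 (q r t : ℝ) (hq : 2 < q)
    (hr : 4 * (q - 1) / (q + 2) < r) (hrt : r ≤ t)
    (hsum : 1 / r + 1 / t ≤ (q / (q - 1)) / 2)
    (g : Lp ℂ 2 (volume : Measure ℝ)) (hg : IsExactCqSystem q (gaborSystem g)) :
    (momentL2 r g = ∞ ∨ momentL2 t (𝓕 g) = ∞) ∧
      (momentL2 t g = ∞ ∨ momentL2 r (𝓕 g) = ∞) := by
  refine ⟨momentL2_eq_top_or hq hr (hr.trans_le hrt) hsum hg,
    momentL2_eq_top_or hq (hr.trans_le hrt) hr ?_ hg⟩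
  rw [add_comm]
  exact hsum
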